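/- Consider the problem $\min_{x\in\mathbb R^n} f(x)+h(x)$ subject to $g_i(x)\le 0$ for $i=1,\dots,m$, under the following assumptions. (A) $f:\mathbb R^n\to\mathbb R$ is convex and differentiable with Lipschitz continuous gradient; $h:\mathbb R^n\to(-\infty,+\infty]$ is proper, lower semicontinuous and convex, with bounded domain $\operatorname{dom}h$, and $\min_v\langle u,v\rangle+h(v)$ has a minimizer for every $u\in\mathbb R^n$; each $g_i:\mathbb R^n\to\mathbb R$ is convex and differentiable, with $\nabla g_i$ Lipschitz continuous on $\operatorname{dom}h$; and the problem has a KKT point, that is, a pair $(x^*,z^*)\in\mathbb R^n\times\mathbb R^m$ with $0\in\nabla f(x^*)+\partial h(x^*)+\sum_i z_i^*\nabla g_i(x^*)$, $g_i(x^*)\le0$ and $z_i^*\ge0$ for all $i$, and $\sum_i z_i^*g_i(x^*)=0$. (B) $h$ is the indicator function ($0$ on $\mathcal C$, $+\infty$ elsewhere) of a compact convex set $\mathcal C$ that is $(\nu,q)$-uniformly convex for some $\nu>0$, $q\ge2$: for all $x,y\in\mathcal C$, $t\in[0,1]$ and all $w$ with $\|w\|=1$, $tx+(1-t)y+t(1-t)\nu\|x-y\|^q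 w\in\mathcal C$. Moreover, for some $\epsilon>0$, the infimum of $\|\nabla f(x)+\sum_i z_i\nabla g_i(x)\|$ over all $x\in\mathcal C$, $z\in\mathbb R^m_+$ such that $g_i(x)\le\epsilon$ for all $i$ and $z_i=0$ whenever $g_i(x)<-\epsilon$, is positive. For $\lambda>0$ put $$F_\lambda(x,z)=f(x)+\frac\lambda2\sum_{i=1}^m\Big(\big[g_i(x)+\tfrac{z_i}{\lambda}\big]_+^2-\big(\tfrac{z_i}{\lambda}\big)^2\Big),\qquad \mathcal L_\lambda(x,z)=F_\lambda(x,z)+h(x),$$ and let $L^*$ be the optimal value of the problem. Let $(x^k,z^k)$ be generated by the following algorithm: $x^0\in\operatorname{dom}h$, $z^0\in\mathbb R^m_+$ and, for $k\ge0$, $$v^k\in\operatorname{Arg\,min}_v\ \langle\nabla_xF_{\lambda_k}(x^k,z^k),v\rangle+h(v),\qquad x^{k+1}=x^k+\alpha_k(v^k-x^k),$$ $$z^{k+1}=z^k+\sigma_k\max\{-z^k/\lambda_k,\,g(x^{k+1})\}\quad\text{(componentwise)},$$ where (C) $0<\lambda_k<\lambda_{k+1}$, $\lambda_k=\Theta(k^{\tau})$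 and $\lambda_{k+1}-\lambda_k=\mathcal O(k^{-(1-\tau)})$ for some $\tau\in(0,1)$; $\alpha_k\in(0,1]$ is nonincreasing and $\alpha_k=\Theta(k^{-p})$ for some $p\in(\tau,1)$; and $0<\sigma_k\le\lambda_k$, $\sigma_k=\Theta(k^{-(1+\gamma)})$ for some $\gamma>0$. Let $T_k=[\mathcal L_{\lambda_k}(x^k,z^k)-L^*]_+$, $\mu=1-2/q$ and $\omega=\min\{p-\tau,\,1-p+\tau\}$. Then $$T_k=\begin{cases}\mathcal O\big(k^{-(1-p+\tau)}\big)&\text{if }\mu=0,\\[2pt] \mathcal O\big(\max\{k^{-((1-\mu)\omega+p-\tau)},\,k^{-(1-p+\tau)}\}\big)&\text{if }\mu\in(0,1).\end{cases}$$ Moreover, if $\mu=0$ (that is, $\mathcal C$ is strongly convex), the rates can be made arbitrarily close to $\mathcal O(1/k)$: for every $\rho<1$ there is $\tau_0<1$ such that, whenever $\tau>\tau_0$, each of $T_k$, $|f(x^k)+h(x^k)-L^*|$ and $\|[g(x^k)]_+\|$ is $\mathcal O(k^{-\rho})$. -/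

import Mathlib

namespace CGAL

open Filter Asymptotics

noncomputable section

/-! ### The problem `min f(x) + h(x)` subject to `g i x ≤ 0`, with `h` extended-real-valued -/

/-- The effective domain of an extended-real-valued function. -/
def dom {n : ℕ} (h : EuclideanSpace ℝ (Fin n) → EReal) : Set (EuclideanSpace ℝ (Fin n)) :=
  {x | h x < ⊤}

/-- The indicator function of a set in the sense of convex analysis: `0` on `C`, `∞` off `C`. -/
def ind {n : ℕ} (C : Set (EuclideanSpace ℝ (Fin n))) (x : EuclideanSpace ℝ (Fin n)) : EReal :=
  open Classical in if x ∈ C then 0 else ⊤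

/-- The (convex) subdifferential of `h` at `x`. -/
def subdifferential {n : ℕ} (h : EuclideanSpace ℝ (Fin n) → EReal)
    (x : EuclideanSpace ℝ (Fin n)) : Set (EuclideanSpace ℝ (Fin n)) :=
  {ξ | ∀ y, h x + ((inner ℝ ξ (y - x) : ℝ) : EReal) ≤ h y}

/-- `v` is a solution of the linear minimization problem `min_v ⟨u, v⟩ + h v`. -/
def IsLMO {n : ℕ} (h : EuclideanSpace ℝ (Fin n) → EReal) (u v : EuclideanSpace ℝ (Fin n)) : Prop :=
  ∀ w, ((inner ℝ u v : ℝ) : EReal) + h v ≤ ((inner ℝ u w : ℝ) : EReal) + h w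

/-- `(x, z)` is a KKT point of the problem. -/
structure IsKKT {n m : ℕ} (f : EuclideanSpace ℝ (Fin n) → ℝ)
    (h : EuclideanSpace ℝ (Fin n) → EReal) (g : Fin m → EuclideanSpace ℝ (Fin n) → ℝ)
    (x : EuclideanSpace ℝ (Fin n)) (z : EuclideanSpace ℝ (Fin m)) : Prop where
  stationary : ∃ ξ ∈ subdifferential h x, gradient f x + ξ + ∑ i, z i • gradient (g i) x = 0
  feasible : ∀ i, g i x ≤ 0
  dual_nonneg : ∀ i, 0 ≤ z i
  complementary : ∑ i, z i * g i x = 0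

/-- Standing assumptions on `f`, `h` and `g`. -/
structure StandingAssumption {n m : ℕ} (f : EuclideanSpace ℝ (Fin n) → ℝ)
    (h : EuclideanSpace ℝ (Fin n) → EReal)
    (g : Fin m → EuclideanSpace ℝ (Fin n) → ℝ) : Prop where
  f_convex : ConvexOn ℝ Set.univ f
  f_differentiable : Differentiable ℝ f
  f_lipschitz : ∃ L : ℝ, 0 < L ∧ ∀ x y, ‖gradient f x - gradient f y‖ ≤ L * ‖x - y‖
  h_ne_bot : ∀ x, h x ≠ ⊥
  h_proper : (dom h).Nonempty
  h_closed : LowerSemicontinuous h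
  h_convex : Convex ℝ {P : EuclideanSpace ℝ (Fin n) × ℝ | h P.1 ≤ (P.2 : EReal)}
  h_bounded : ∃ D : ℝ, 0 < D ∧ ∀ x ∈ dom h, ∀ y ∈ dom h, ‖x - y‖ ≤ D
  h_lmo : ∀ u, ∃ v, IsLMO h u v
  g_convex : ∀ i, ConvexOn ℝ Set.univ (g i)
  g_differentiable : ∀ i, Differentiable ℝ (g i)
  g_lipschitz : ∀ i, ∃ L : ℝ, 0 < L ∧
    ∀ x ∈ dom h, ∀ y ∈ dom h, ‖gradient (g i) x - gradient (g i) y‖ ≤ L * ‖x - y‖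
  exists_kkt : ∃ x z, IsKKT f h g x z

/-- The optimal value `L*` of the problem. -/
def optValue {n m : ℕ} (f : EuclideanSpace ℝ (Fin n) → ℝ)
    (h : EuclideanSpace ℝ (Fin n) → EReal) (g : Fin m → EuclideanSpace ℝ (Fin n) → ℝ) : EReal :=
  ⨅ x ∈ {x | ∀ i, g i x ≤ 0}, (f x : EReal) + h x

/-! ### The augmented Lagrangian -/

/-- `ψ_t(u, v) = (t / 2) ([u + v / t]₊² - (v / t)²)`. -/
def psi (t u v : ℝ) : ℝ := t / 2 * ((max (u + v / t) 0) ^ 2 - (v / t) ^ 2)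

/-- The smooth part `F_λ(x, z) = f x + ∑ i, ψ_λ(g i x, z i)` of the augmented Lagrangian. -/
def smoothPart {n m : ℕ} (f : EuclideanSpace ℝ (Fin n) → ℝ)
    (g : Fin m → EuclideanSpace ℝ (Fin n) → ℝ) (lam : ℝ)
    (x : EuclideanSpace ℝ (Fin n)) (z : EuclideanSpace ℝ (Fin m)) : ℝ :=
  f x + ∑ i, psi lam (g i x) (z i)

/-- The augmented Lagrangian `𝓛_λ(x, z) = F_λ(x, z) + h x`. -/
def augLagrangian {n m : ℕ} (f : EuclideanSpace ℝ (Fin n) → ℝ)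
    (h : EuclideanSpace ℝ (Fin n) → EReal) (g : Fin m → EuclideanSpace ℝ (Fin n) → ℝ)
    (lam : ℝ) (x : EuclideanSpace ℝ (Fin n)) (z : EuclideanSpace ℝ (Fin m)) : EReal :=
  (smoothPart f g lam x z : EReal) + h x

/-- `T_λ(x, z) = [𝓛_λ(x, z) - L*]₊`. -/
def gapT {n m : ℕ} (f : EuclideanSpace ℝ (Fin n) → ℝ)
    (h : EuclideanSpace ℝ (Fin n) → EReal) (g : Fin m → EuclideanSpace ℝ (Fin n) → ℝ)
    (lam : ℝ) (x : EuclideanSpace ℝ (Fin n)) (z : EuclideanSpace ℝ (Fin m)) : EReal :=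
  max (augLagrangian f h g lam x z - optValue f h g) 0

/-! ### The algorithm -/

/-- The sequences `x, z, v` are generated by the single-loop conditional-gradient augmented
Lagrangian method with primal stepsizes `α`, penalty parameters `lam`, dual stepsizes `σ`. -/
structure IsRun {n m : ℕ} (f : EuclideanSpace ℝ (Fin n) → ℝ)
    (h : EuclideanSpace ℝ (Fin n) → EReal) (g : Fin m → EuclideanSpace ℝ (Fin n) → ℝ)
    (α lam σ : ℕ → ℝ) (x : ℕ → EuclideanSpace ℝ (Fin n)) (z : ℕ → EuclideanSpace ℝ (Fin m))
    (v : ℕ → EuclideanSpace ℝ (Fin n)) : Prop where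
  x_zero : x 0 ∈ dom h
  z_zero : ∀ i, 0 ≤ z 0 i
  α_mem : ∀ k, α k ∈ Set.Icc (0 : ℝ) 1
  lam_pos : ∀ k, 0 < lam k
  lam_strictMono : StrictMono lam
  lam_tendsto : Tendsto lam atTop atTop
  σ_pos : ∀ k, 0 < σ k
  σ_summable : Summable σ
  σ_le : ∀ k, σ k ≤ lam k
  v_step : ∀ k, IsLMO h (gradient (fun y => smoothPart f g (lam k) y (z k)) (x k)) (v k)
  x_step : ∀ k, x (k + 1) = x k + α k • (v k - x k)
  z_step : ∀ k i, z (k + 1) i = z k i + σ k * max (-(z k i) / lam k) (g i (x (k + 1)))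

/-- Parameter rules of the open-loop stepsize, with exponents `τ, p, γ`. -/
structure OpenLoop (τ p γ : ℝ) (α lam σ : ℕ → ℝ) : Prop where
  τ_mem : τ ∈ Set.Ioo (0 : ℝ) 1
  p_mem : p ∈ Set.Ioo τ 1
  γ_pos : 0 < γ
  lam_pos : ∀ k, 0 < lam k
  lam_strictMono : StrictMono lam
  lam_theta : lam =Θ[atTop] fun k : ℕ => (k : ℝ) ^ τ
  lam_diff : (fun k => lam (k + 1) - lam k) =O[atTop] fun k : ℕ => (k : ℝ) ^ (-(1 - τ))
  α_mem : ∀ k, α k ∈ Set.Ioc (0 : ℝ) 1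
  α_antitone : Antitone α
  α_theta : α =Θ[atTop] fun k : ℕ => (k : ℝ) ^ (-p)
  σ_pos : ∀ k, 0 < σ k
  σ_le : ∀ k, σ k ≤ lam k
  σ_theta : σ =Θ[atTop] fun k : ℕ => (k : ℝ) ^ (-(1 + γ))

/-! ### Uniformly convex sets -/

/-- `(ν, q)`-uniformly convex sets. -/
structure UniformlyConvexSet {n : ℕ} (ν q : ℝ) (D : Set (EuclideanSpace ℝ (Fin n))) : Prop where
  ν_pos : 0 < ν
  two_le_q : 2 ≤ q
  convex : Convex ℝ D
  ball_mem : ∀ x ∈ D, ∀ y ∈ D, ∀ t ∈ Set.Icc (0 : ℝ) 1, ∀ w : EuclideanSpace ℝ (Fin n), ‖w‖ = 1 →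
    t • x + (1 - t) • y + (t * (1 - t) * ν * ‖x - y‖ ^ q) • w ∈ D

/-- The set `𝓐_ε` of pairs `(x, z)` with `g x ≤ ε`, `z ≥ 0`, and `z i = 0` whenever
`g i x < -ε`. -/
def setA {n m : ℕ} (g : Fin m → EuclideanSpace ℝ (Fin n) → ℝ) (ε : ℝ) :
    Set (EuclideanSpace ℝ (Fin n) × EuclideanSpace ℝ (Fin m)) :=
  {P | (∀ i, g i P.1 ≤ ε) ∧ (∀ i, 0 ≤ P.2 i) ∧ ∀ i, g i P.1 < -ε → P.2 i = 0}

/-- The function `h` is the indicator of a compact `(ν, q)`-uniformly convex set `C`, and for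
some `ε > 0` the infimum of `‖∇f(x) + ∑ i, z i ∇(g i)(x)‖` over `(x, z) ∈ 𝓐_ε`, `x ∈ C`, is
positive. -/
structure UCAssumption {n m : ℕ} (f : EuclideanSpace ℝ (Fin n) → ℝ)
    (h : EuclideanSpace ℝ (Fin n) → EReal) (g : Fin m → EuclideanSpace ℝ (Fin n) → ℝ)
    (C : Set (EuclideanSpace ℝ (Fin n))) (ν q : ℝ) : Prop where
  h_eq : h = ind C
  compact : IsCompact C
  uniformlyConvex : UniformlyConvexSet ν q C
  grad_bound : ∃ ε : ℝ, 0 < ε ∧ ∃ ζ : ℝ, 0 < ζ ∧ ∀ x z, (x, z) ∈ setA g ε → x ∈ C →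
    ζ ≤ ‖gradient f x + ∑ i, z i • gradient (g i) x‖

/-! ### Rates -/

/-- The extended-real sequence `a` is finite and `a k = O(r k)` as `k → ∞`. -/
def HasRate (a : ℕ → EReal) (r : ℕ → ℝ) : Prop :=
  (∀ k, a k ≠ ⊥ ∧ a k ≠ ⊤) ∧ (fun k => (a k).toReal) =O[atTop] r

end

end CGAL

/-!
The convergence argument takes place in a real inner product space and uses the objective and the
constraints only through their values and Lipschitz subgradients on the bounded convex set `C`.

A Frank–Wolfe step with stepsize `α` decreases `F_λ - L*` by `α` times the Frank–Wolfe gap, up to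
a curvature term of order `α (λ α) ‖v - x‖²`; the gap dominates `F_λ - L*` by convexity. Updating
the penalty and the multipliers costs a multiple of `∑ w_i²`, where `w` is the direction of the
multiplier step, and comparison with a saddle point `(x*, z*)` gives
`λ/4 ∑ w_i² ≤ F_λ - L* + O(1/λ)`. Bounding `‖v - x‖` by the diameter of `C` already shows that
`F_λ - L*` stays bounded; hence `x` becomes almost feasible, so that the gradient of `F_λ` is
eventually bounded away from zero. The uniform convexity of `C` then bounds `κ ‖v - x‖^q` by the
Frank–Wolfe gap, which absorbs the curvature term up to a remainder of the order of the claimed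
rate.
-/

namespace CGAL

open Filter Asymptotics
open scoped InnerProductSpace NNReal

/-! ### The penalty function `psi` -/

/-- The minimizer of `w ↦ t / 2 * w ^ 2 + v * w` over `w ≥ u`. With `u = g i x`, `v = z i` and
`t = λ` it is the direction in which the algorithm moves the multiplier of the `i`-th
constraint. -/
noncomputable def residual (t u v : ℝ) : ℝ := max (-v / t) u

section Psi

variable {t u v : ℝ}

lemma psi_le_of_le (ht : 0 < t) {w : ℝ} (hw : u ≤ w) (v : ℝ) :
    psi t u v ≤ t / 2 * w ^ 2 + v * w := by
  have complete_square : t / 2 * w ^ 2 + v * w = t / 2 * ((w + v / t) ^ 2 - (v / t) ^ 2) := by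
    field_simp; ring
  rw [complete_square, psi]
  have : (max (u + v / t) 0) ^ 2 ≤ (w + v / t) ^ 2 := by
    rcases max_cases (u + v / t) 0 with ⟨h, _⟩ | ⟨h, _⟩ <;> rw [h] <;> nlinarith
  gcongr

lemma psi_eq_residual (ht : 0 < t) (u v : ℝ) :
    psi t u v = t / 2 * residual t u v ^ 2 + v * residual t u v := by
  have h : residual t u v + v / t = max (u + v / t) 0 := by
    rw [residual, max_comm, max_add, neg_div, neg_add_cancel]
  rw [psi, ← h]
  field_simp
  ring

lemma psi_update_le {t' : ℝ} (ht : 0 < t) (ht' : 0 < t') (u v v' : ℝ) :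
    psi t' u v' ≤
      psi t u v + (t' - t) / 2 * residual t u v ^ 2 + (v' - v) * residual t u v := by
  have h := psi_le_of_le ht' (show u ≤ residual t u v from le_max_right _ _) v'
  rw [psi_eq_residual ht]
  linarith

lemma psi_nonpos (ht : 0 < t) (hu : u ≤ 0) (v : ℝ) : psi t u v ≤ 0 := by
  simpa using psi_le_of_le ht hu v

lemma neg_sq_div_le_psi (ht : 0 < t) (u v : ℝ) : -(v ^ 2 / (2 * t)) ≤ psi t u v := by
  have h : -(v ^ 2 / (2 * t)) = t / 2 * (0 - (v / t) ^ 2) := by field_simp; ring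
  rw [h, psi]
  gcongr
  positivity

lemma max_mul_add_eq (ht : 0 < t) (u v : ℝ) : max (t * u + v) 0 = t * max (u + v / t) 0 := by
  rw [mul_max_of_nonneg _ _ ht.le, mul_zero, mul_add, mul_div_cancel₀ _ ht.ne']

lemma psi_add_slope_mul_le (ht : 0 < t) (u u' v : ℝ) :
    psi t u v + max (t * u + v) 0 * (u' - u) ≤ psi t u' v := by
  have tangent (a b : ℝ) : max a 0 ^ 2 + 2 * max a 0 * (b - a) ≤ max b 0 ^ 2 := by
    rcases max_cases a 0 with ⟨h, _⟩ | ⟨h, _⟩ <;>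
      rcases max_cases b 0 with ⟨k, _⟩ | ⟨k, _⟩ <;> rw [h, k] <;> nlinarith [sq_nonneg (b - a)]
  have h := mul_le_mul_of_nonneg_left (tangent (u + v / t) (u' + v / t)) (half_pos ht).le
  rw [max_mul_add_eq ht, psi, psi]
  linarith

lemma psi_le_add_slope_mul_add_sq (ht : 0 < t) (u u' v : ℝ) :
    psi t u' v ≤ psi t u v + max (t * u + v) 0 * (u' - u) + t / 2 * (u' - u) ^ 2 := by
  have parabola (a b : ℝ) :
      max b 0 ^ 2 ≤ max a 0 ^ 2 + 2 * max a 0 * (b - a) + (b - a) ^ 2 := by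
    rcases max_cases a 0 with ⟨h, _⟩ | ⟨h, _⟩ <;>
      rcases max_cases b 0 with ⟨k, _⟩ | ⟨k, _⟩ <;> rw [h, k] <;> nlinarith
  have h := mul_le_mul_of_nonneg_left (parabola (u + v / t) (u' + v / t)) (half_pos ht).le
  rw [max_mul_add_eq ht, psi, psi]
  linarith

lemma hasDerivAt_psi (ht : 0 < t) (u v : ℝ) :
    HasDerivAt (fun u => psi t u v) (max (t * u + v) 0) u := by
  refine .of_isLittleO <| IsBigO.trans_isLittleO (g := fun y => ‖y - u‖ ^ 2) ?_
    (isLittleO_pow_sub_sub u one_lt_two)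
  refine .of_bound (t / 2) (.of_forall fun y => ?_)
  have hlower := psi_add_slope_mul_le ht u y v
  have hupper := psi_le_add_slope_mul_add_sq ht u y v
  rw [smul_eq_mul, Real.norm_of_nonneg (by linarith), norm_pow, norm_norm, Real.norm_eq_abs,
    sq_abs]
  linarith

lemma residual_sq_le_psi (ht : 0 < t) {s : ℝ} (hs : 0 ≤ s) (u v : ℝ) :
    t / 4 * residual t u v ^ 2 ≤ psi t u v - s * u + (v - s) ^ 2 / t := by
  set w := residual t u v
  have hsw : s * u ≤ s * w := mul_le_mul_of_nonneg_left (le_max_right _ _) hs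
  have hsq : 0 ≤ t / 4 * w ^ 2 + (v - s) * w + (v - s) ^ 2 / t := by
    calc 0 ≤ t * (w / 2 + (v - s) / t) ^ 2 := by positivity
      _ = t / 4 * w ^ 2 + (v - s) * w + (v - s) ^ 2 / t := by field_simp; ring
  rw [psi_eq_residual ht]
  linarith

end Psi

/-! ### Convex functions with a Lipschitz subgradient -/

variable {E : Type*} [NormedAddCommGroup E] [InnerProductSpace ℝ E]

/-- `f'` is a Lipschitz selection of subgradients on `C` of the function `f`: the first-order
information on convex functions which the conditional gradient method exploits. -/
structure SmoothConvexOn (C : Set E) (f : E → ℝ) (f' : E → E) : Prop where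
  add_inner_le : ∀ x ∈ C, ∀ y ∈ C, f x + ⟪f' x, y - x⟫_ℝ ≤ f y
  exists_lipschitz : ∃ L, LipschitzOnWith L f' C

lemma exists_norm_le_of_lipschitzOnWith {X F : Type*} [PseudoMetricSpace X]
    [SeminormedAddCommGroup F] {C : Set X} {f : X → F} {K : ℝ≥0} (hf : LipschitzOnWith K f C)
    (hC : Bornology.IsBounded C) : ∃ M : ℝ≥0, ∀ x ∈ C, ‖f x‖ ≤ M := by
  obtain ⟨D, hD⟩ := Metric.isBounded_iff.1 hC
  have hfC : Bornology.IsBounded (f '' C) := Metric.isBounded_image_iff.2 ⟨K * D, fun x hx y hy =>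
    (hf.dist_le_mul x hx y hy).trans (mul_le_mul_of_nonneg_left (hD hx hy) K.coe_nonneg)⟩
  obtain ⟨M, hM, h⟩ := hfC.exists_pos_norm_le
  exact ⟨.mk M hM.le, fun x hx => h _ (Set.mem_image_of_mem f hx)⟩

namespace SmoothConvexOn

variable {C : Set E} {f : E → ℝ} {f' : E → E}

lemma exists_le_add_inner_add_sq (hf : SmoothConvexOn C f f') :
    ∃ L : ℝ≥0, ∀ x ∈ C, ∀ y ∈ C, f y ≤ f x + ⟪f' x, y - x⟫_ℝ + L * ‖y - x‖ ^ 2 := by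
  obtain ⟨L, hL⟩ := hf.exists_lipschitz
  refine ⟨L, fun x hx y hy => ?_⟩
  have hsub := hf.add_inner_le y hy x hx
  have hlip : ⟪f' y - f' x, y - x⟫_ℝ ≤ L * ‖y - x‖ ^ 2 :=
    calc ⟪f' y - f' x, y - x⟫_ℝ ≤ ‖f' y - f' x‖ * ‖y - x‖ := real_inner_le_norm _ _
      _ ≤ L * ‖y - x‖ * ‖y - x‖ := by gcongr; exact hL.norm_sub_le hy hx
      _ = L * ‖y - x‖ ^ 2 := by ring
  rw [← neg_sub y x, inner_neg_right] at hsub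
  rw [inner_sub_left] at hlip
  linarith

lemma exists_lipschitzOnWith (hf : SmoothConvexOn C f f') (hC : Bornology.IsBounded C) :
    ∃ G, LipschitzOnWith G f C := by
  obtain ⟨L, hL⟩ := hf.exists_lipschitz
  obtain ⟨G, hG⟩ := exists_norm_le_of_lipschitzOnWith hL hC
  refine ⟨G, .of_le_add_mul G fun x hx y hy => ?_⟩
  have hsub := hf.add_inner_le x hx y hy
  have hinner : ⟪f' x, x - y⟫_ℝ ≤ G * dist x y := by
    rw [dist_eq_norm]
    exact (real_inner_le_norm _ _).trans (by gcongr; exact hG x hx)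
  rw [← neg_sub x y, inner_neg_right] at hsub
  linarith

lemma exists_abs_le (hf : SmoothConvexOn C f f') (hC : Bornology.IsBounded C) :
    ∃ M : ℝ≥0, ∀ x ∈ C, |f x| ≤ M := by
  obtain ⟨G, hG⟩ := hf.exists_lipschitzOnWith hC
  exact exists_norm_le_of_lipschitzOnWith hG hC

lemma psi_comp_add_inner_le (hf : SmoothConvexOn C f f') {t : ℝ} (ht : 0 < t) (v : ℝ) {x y : E}
    (hx : x ∈ C) (hy : y ∈ C) :
    psi t (f x) v + max (t * f x + v) 0 * ⟪f' x, y - x⟫_ℝ ≤ psi t (f y) v := by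
  have hslope : max (t * f x + v) 0 * ⟪f' x, y - x⟫_ℝ ≤ max (t * f x + v) 0 * (f y - f x) :=
    mul_le_mul_of_nonneg_left (by linarith [hf.add_inner_le x hx y hy]) (le_max_right _ _)
  linarith [psi_add_slope_mul_le ht (f x) (f y) v]

lemma exists_psi_comp_le (hf : SmoothConvexOn C f f') (hC : Bornology.IsBounded C) {l : ℝ}
    (hl : 0 < l) (Z : ℝ) :
    ∃ c : ℝ≥0, ∀ t v, l ≤ t → v ≤ Z → ∀ x ∈ C, ∀ y ∈ C,
      psi t (f y) v ≤ psi t (f x) v + max (t * f x + v) 0 * ⟪f' x, y - x⟫_ℝ +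
        c * t * ‖y - x‖ ^ 2 := by
  obtain ⟨L, hL⟩ := hf.exists_le_add_inner_add_sq
  obtain ⟨G, hG⟩ := hf.exists_lipschitzOnWith hC
  obtain ⟨M, hM⟩ := hf.exists_abs_le hC
  refine ⟨.mk ((M + |Z| / l) * L + G ^ 2 / 2) (by positivity), fun t v ht hv x hx y hy => ?_⟩
  have ht0 : 0 < t := hl.trans_le ht
  set s := max (t * f x + v) 0
  have hs : s ≤ (M + |Z| / l) * t := by
    have hZ : |Z| ≤ |Z| / l * t := by rw [div_mul_eq_mul_div, le_div_iff₀ hl]; gcongr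
    have hfx : t * f x ≤ t * M := by gcongr; exact (le_abs_self _).trans (hM x hx)
    exact max_le (by linarith [le_abs_self Z]) (by positivity)
  have hlin : s * (f y - f x) ≤ s * ⟪f' x, y - x⟫_ℝ + (M + |Z| / l) * t * (L * ‖y - x‖ ^ 2) :=
    calc s * (f y - f x) ≤ s * (⟪f' x, y - x⟫_ℝ + L * ‖y - x‖ ^ 2) :=
          mul_le_mul_of_nonneg_left (by linarith [hL x hx y hy]) (le_max_right _ _)
      _ ≤ s * ⟪f' x, y - x⟫_ℝ + (M + |Z| / l) * t * (L * ‖y - x‖ ^ 2) := by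
          rw [mul_add]; gcongr
  have hquad : t / 2 * (f y - f x) ^ 2 ≤ t / 2 * (G * ‖y - x‖) ^ 2 := by
    rw [← sq_abs]
    gcongr
    exact hG.norm_sub_le hy hx
  have hpsi := psi_le_add_slope_mul_add_sq ht0 (f x) (f y) v
  rw [NNReal.coe_mk]
  linarith

end SmoothConvexOn

/-! ### The augmented Lagrangian of a convex program -/

variable {ι : Type*}

/-- The convex program of minimizing `f` over a bounded convex set `C` subject to `g i x ≤ 0`, with
first-order information `f'` and `g'` on its data. -/
structure Program (E ι : Type*) [NormedAddCommGroup E] [InnerProductSpace ℝ E] where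
  C : Set E
  f : E → ℝ
  f' : E → E
  g : ι → E → ℝ
  g' : ι → E → E
  convex : Convex ℝ C
  isBounded : Bornology.IsBounded C
  smooth_f : SmoothConvexOn C f f'
  smooth_g : ∀ i, SmoothConvexOn C (g i) (g' i)

/-- `v` solves the linear minimization problem `min ⟨u, v⟩` over `v ∈ C`. -/
def IsLinMin (C : Set E) (u v : E) : Prop := v ∈ C ∧ ∀ w ∈ C, ⟪u, v⟫_ℝ ≤ ⟪u, w⟫_ℝ

namespace Program

/-- The multiplier estimates `[λ g i x + z i]₊`. -/
noncomputable def multiplier (P : Program E ι) (lam : ℝ) (x : E) (z : ι → ℝ) (i : ι) : ℝ :=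
  max (lam * P.g i x + z i) 0

variable [Fintype ι]

/-- The subgradient `f'(x) + ∑ z i g i'(x)` of the Lagrangian. -/
noncomputable def lagGrad (P : Program E ι) (x : E) (z : ι → ℝ) : E :=
  P.f' x + ∑ i, z i • P.g' i x

/-- The augmented Lagrangian `F_λ(x, z)`; it is `smoothPart` for multipliers in `ι → ℝ`. -/
noncomputable def augF (P : Program E ι) (lam : ℝ) (x : E) (z : ι → ℝ) : ℝ :=
  P.f x + ∑ i, psi lam (P.g i x) (z i)

/-- The subgradient of the augmented Lagrangian in `x`. -/
noncomputable def augGrad (P : Program E ι) (lam : ℝ) (x : E) (z : ι → ℝ) : E :=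
  P.lagGrad x (P.multiplier lam x z)

/-- The Frank–Wolfe gap `⟨∇F_λ(x, z), x - v⟩` at the oracle point `v`. -/
noncomputable def fwGap (P : Program E ι) (lam : ℝ) (x : E) (z : ι → ℝ) (v : E) : ℝ :=
  ⟪P.augGrad lam x z, x - v⟫_ℝ

/-- The optimality gap `[F_λ(x, z) - f(x*)]₊` relative to the point `xs = x*`. -/
noncomputable def gap (P : Program E ι) (xs : E) (lam : ℝ) (x : E) (z : ι → ℝ) : ℝ :=
  max (P.augF lam x z - P.f xs) 0

/-- `(xs, zs)` is a primal-dual optimal pair, in the form of a saddle inequality for the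
Lagrangian. -/
structure IsSaddle (P : Program E ι) (xs : E) (zs : ι → ℝ) : Prop where
  mem : xs ∈ P.C
  feasible : ∀ i, P.g i xs ≤ 0
  nonneg : ∀ i, 0 ≤ zs i
  le_lagrangian : ∀ y ∈ P.C, P.f xs ≤ P.f y + ∑ i, zs i * P.g i y

/-- The Lagrangian subgradient is bounded away from zero at nearly feasible points, for
multipliers that vanish on the clearly inactive constraints. -/
def Nondegenerate (P : Program E ι) : Prop :=
  ∃ ε > 0, ∃ ζ > 0, ∀ x ∈ P.C, ∀ z : ι → ℝ, (∀ i, P.g i x ≤ ε) → (∀ i, 0 ≤ z i) →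
    (∀ i, P.g i x < -ε → z i = 0) → ζ ≤ ‖P.lagGrad x z‖

variable {P : Program E ι} {xs x y v : E} {zs z : ι → ℝ} {lam : ℝ}

lemma inner_augGrad (P : Program E ι) (lam : ℝ) (x : E) (z : ι → ℝ) (d : E) :
    ⟪P.augGrad lam x z, d⟫_ℝ =
      ⟪P.f' x, d⟫_ℝ + ∑ i, max (lam * P.g i x + z i) 0 * ⟪P.g' i x, d⟫_ℝ := by
  simp only [augGrad, lagGrad, multiplier, inner_add_left, sum_inner, real_inner_smul_left]

lemma augF_add_inner_le (hlam : 0 < lam) (hx : x ∈ P.C) (hy : y ∈ P.C) (z : ι → ℝ) :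
    P.augF lam x z + ⟪P.augGrad lam x z, y - x⟫_ℝ ≤ P.augF lam y z := by
  have hpsi := Finset.sum_le_sum fun i (_ : i ∈ Finset.univ) =>
    (P.smooth_g i).psi_comp_add_inner_le hlam (z i) hx hy
  rw [Finset.sum_add_distrib] at hpsi
  rw [inner_augGrad, augF, augF]
  linarith [P.smooth_f.add_inner_le x hx y hy]

lemma augF_le_of_feasible (hlam : 0 < lam) (hx : ∀ i, P.g i x ≤ 0) (z : ι → ℝ) :
    P.augF lam x z ≤ P.f x := by
  have : ∑ i, psi lam (P.g i x) (z i) ≤ 0 :=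
    Finset.sum_nonpos fun i _ => psi_nonpos hlam (hx i) (z i)
  rw [augF]
  linarith

lemma exists_augF_le (P : Program E ι) {l : ℝ} (hl : 0 < l) (Z : ι → ℝ) :
    ∃ c : ℝ≥0, ∀ lam, ∀ z : ι → ℝ, l ≤ lam → z ≤ Z → ∀ x ∈ P.C, ∀ y ∈ P.C,
      P.augF lam y z ≤
        P.augF lam x z + ⟪P.augGrad lam x z, y - x⟫_ℝ + c * lam * ‖y - x‖ ^ 2 := by
  obtain ⟨L, hL⟩ := P.smooth_f.exists_le_add_inner_add_sq
  choose c hc using fun i => (P.smooth_g i).exists_psi_comp_le P.isBounded hl (Z i)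
  refine ⟨.mk (L / l + ∑ i, c i) (by positivity), fun lam z hlam hz x hx y hy => ?_⟩
  have hpsi := Finset.sum_le_sum fun i (_ : i ∈ Finset.univ) =>
    hc i lam (z i) hlam (hz i) x hx y hy
  simp only [Finset.sum_add_distrib, ← Finset.sum_mul] at hpsi
  have hLl : L * ‖y - x‖ ^ 2 ≤ L / l * lam * ‖y - x‖ ^ 2 := by
    gcongr
    rw [div_mul_eq_mul_div, le_div_iff₀ hl]
    gcongr
  rw [inner_augGrad, augF, augF, NNReal.coe_mk]
  push_cast
  linarith [hL x hx y hy]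

lemma fwGap_nonneg (hv : IsLinMin P.C (P.augGrad lam x z) v) (hx : x ∈ P.C) :
    0 ≤ P.fwGap lam x z v := by
  rw [fwGap, inner_sub_right, sub_nonneg]
  exact hv.2 x hx

lemma gap_nonneg (P : Program E ι) (xs : E) (lam : ℝ) (x : E) (z : ι → ℝ) :
    0 ≤ P.gap xs lam x z := le_max_right _ _

lemma sub_le_gap (P : Program E ι) (xs : E) (lam : ℝ) (x : E) (z : ι → ℝ) :
    P.augF lam x z - P.f xs ≤ P.gap xs lam x z := le_max_left _ _

namespace IsSaddle

lemma gap_le_fwGap (hs : P.IsSaddle xs zs) (hlam : 0 < lam)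
    (hv : IsLinMin P.C (P.augGrad lam x z) v) (hx : x ∈ P.C) :
    P.gap xs lam x z ≤ P.fwGap lam x z v := by
  refine max_le ?_ (fwGap_nonneg hv hx)
  have hconv := augF_add_inner_le hlam hx hs.mem z
  have hle := augF_le_of_feasible hlam hs.feasible z
  have hmin := hv.2 xs hs.mem
  rw [inner_sub_right] at hconv
  rw [fwGap, inner_sub_right]
  linarith

lemma sum_residual_sq_le (hs : P.IsSaddle xs zs) (hlam : 0 < lam) (hx : x ∈ P.C) (z : ι → ℝ) :
    lam / 4 * ∑ i, residual lam (P.g i x) (z i) ^ 2 ≤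
      P.gap xs lam x z + (∑ i, (z i - zs i) ^ 2) / lam := by
  have hpsi := Finset.sum_le_sum fun i (_ : i ∈ Finset.univ) =>
    residual_sq_le_psi hlam (hs.nonneg i) (P.g i x) (z i)
  rw [Finset.sum_add_distrib, Finset.sum_sub_distrib, ← Finset.mul_sum, ← Finset.sum_div] at hpsi
  have hgap := P.sub_le_gap xs lam x z
  rw [augF] at hgap
  linarith [hs.le_lagrangian x hx]

end IsSaddle

end Program

/-! ### Polynomial rates and recurrences -/

section Rates

variable {u w T : ℕ → ℝ} {a b c p r : ℝ}

lemma tendsto_natCast_rpow_of_neg (ha : a < 0) :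
    Tendsto (fun k : ℕ => (k : ℝ) ^ a) atTop (nhds 0) := by
  have h := (tendsto_rpow_neg_atTop (neg_pos.2 ha)).comp (tendsto_natCast_atTop_atTop (R := ℝ))
  simpa only [neg_neg, Function.comp_def] using h

lemma isBigO_natCast_rpow (hab : a ≤ b) :
    (fun k : ℕ => (k : ℝ) ^ a) =O[atTop] fun k : ℕ => (k : ℝ) ^ b := by
  refine .of_norm_eventuallyLE ?_
  filter_upwards [eventually_ge_atTop 1] with k hk
  rw [Real.norm_of_nonneg (by positivity)]
  exact Real.rpow_le_rpow_of_exponent_le (by exact_mod_cast hk) hab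

lemma natCast_rpow_mul_rpow_eventuallyEq (h : a + b = c) :
    (fun k : ℕ => (k : ℝ) ^ a * (k : ℝ) ^ b) =ᶠ[atTop] fun k : ℕ => (k : ℝ) ^ c := by
  filter_upwards [eventually_ge_atTop 1] with k hk
  rw [← Real.rpow_add (by exact_mod_cast hk), h]

lemma isBigO_mul_rpow (hu : u =O[atTop] fun k : ℕ => (k : ℝ) ^ a)
    (hw : w =O[atTop] fun k : ℕ => (k : ℝ) ^ b) (h : a + b = c) :
    (fun k => u k * w k) =O[atTop] fun k : ℕ => (k : ℝ) ^ c :=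
  (hu.mul hw).trans_eventuallyEq (natCast_rpow_mul_rpow_eventuallyEq h)

lemma isLittleO_natCast_rpow (hab : a < b) :
    (fun k : ℕ => (k : ℝ) ^ a) =o[atTop] fun k : ℕ => (k : ℝ) ^ b := by
  have h := ((isLittleO_one_iff ℝ).2 (tendsto_natCast_rpow_of_neg (sub_neg.2 hab))).mul_isBigO
    (isBigO_refl (fun k : ℕ => (k : ℝ) ^ b) atTop)
  simp only [one_mul] at h
  exact (natCast_rpow_mul_rpow_eventuallyEq (sub_add_cancel a b)).symm.trans_isLittleO h

lemma isBigO_inv_rpow (hu : (fun k : ℕ => (k : ℝ) ^ a) =O[atTop] u) :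
    (fun k => (u k)⁻¹) =O[atTop] fun k : ℕ => (k : ℝ) ^ (-a) := by
  have hne : ∀ᶠ k : ℕ in atTop, (k : ℝ) ^ a = 0 → u k = 0 := by
    filter_upwards [eventually_ge_atTop 1] with k hk h0
    exact absurd h0 (Real.rpow_pos_of_pos (by exact_mod_cast hk) a).ne'
  simpa only [Real.rpow_neg (Nat.cast_nonneg _)] using hu.inv_rev hne

lemma isBigO_rpow_rpow (hb : 0 ≤ b) (hu : u =O[atTop] fun k : ℕ => (k : ℝ) ^ a)
    (h : a * b = c) : (fun k => u k ^ b) =O[atTop] fun k : ℕ => (k : ℝ) ^ c := by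
  simpa only [← Real.rpow_mul (Nat.cast_nonneg _), h] using
    hu.rpow hb (.of_forall fun k : ℕ => by positivity)

lemma rpow_neg_sub_le_rpow_neg_add_one {x : ℝ} (hx : 0 < x) (hr : 0 ≤ r) :
    x ^ (-r) - r * x ^ (-1 - r) ≤ (x + 1) ^ (-r) := by
  have bernoulli : 1 - r * x⁻¹ ≤ (1 + x⁻¹) ^ (-r) := by
    have hlog := Real.log_le_sub_one_of_pos (show 0 < 1 + x⁻¹ by positivity)
    rw [Real.rpow_def_of_pos (by positivity)]
    refine le_trans ?_ (Real.add_one_le_exp _)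
    nlinarith
  have hsplit : x + 1 = x * (1 + x⁻¹) := by field_simp
  rw [sub_eq_add_neg (-1 : ℝ), Real.rpow_add hx, Real.rpow_neg_one, hsplit,
    Real.mul_rpow hx.le (by positivity)]
  have h := mul_le_mul_of_nonneg_left bernoulli (Real.rpow_nonneg hx.le (-r))
  linarith

lemma eventually_rpow_neg_sub_le (hp : p < 1) (hr : 0 ≤ r) (hc : 0 < c) :
    ∀ᶠ k : ℕ in atTop,
      (k : ℝ) ^ (-r) - c * (k : ℝ) ^ (-(p + r)) ≤ ((k + 1 : ℕ) : ℝ) ^ (-r) := by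
  have hlittle := (isLittleO_natCast_rpow (show -1 - r < -(p + r) by linarith)).const_mul_left r
  filter_upwards [hlittle.bound hc, eventually_ge_atTop 1] with k hk hk1
  rw [Real.norm_of_nonneg (by positivity), Real.norm_of_nonneg (by positivity)] at hk
  push_cast
  linarith [rpow_neg_sub_le_rpow_neg_add_one (x := (k : ℝ)) (by exact_mod_cast hk1) hr]

lemma le_mul_of_contraction {A B P Q Q' S t t' : ℝ} (hA : 0 ≤ A) (hc : 0 < c) (hQ : 0 ≤ Q)
    (hP : 0 ≤ P) (ha1 : a ≤ 1) (hPa : P ≤ c * a) (hBA : 2 * c * B ≤ A) (hS : S ≤ B * (P * Q))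
    (hQ' : Q - 1 / (2 * c) * (P * Q) ≤ Q') (ht : t ≤ A * Q) (ht' : t' ≤ (1 - a) * t + S) :
    t' ≤ A * Q' := by
  -- The contraction `a` is split in two halves: one pays for `S`, the other for `Q - Q'`.
  have hpay : A / c * (P * Q) ≤ a * (A * Q) := by
    have hPc : P / c ≤ a := by rwa [div_le_iff₀' hc]
    calc A / c * (P * Q) = P / c * (A * Q) := by ring
      _ ≤ a * (A * Q) := by gcongr
  have hSA : B * (P * Q) ≤ A / (2 * c) * (P * Q) := by
    gcongr
    rwa [le_div_iff₀' (by positivity)]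
  have hhalf : A / c = A / (2 * c) + A * (1 / (2 * c)) := by field_simp; norm_num
  have hcontract := mul_le_mul_of_nonneg_left ht (sub_nonneg.2 ha1)
  have hdecay := mul_le_mul_of_nonneg_left hQ' hA
  rw [hhalf] at hpay
  linarith

lemma isBigO_of_linear_recurrence (hp : p < 1) (hr : 0 ≤ r) {a S : ℕ → ℝ} (hT : ∀ k, 0 ≤ T k)
    (ha1 : ∀ᶠ k in atTop, a k ≤ 1) (ha : ∀ k, 0 ≤ a k)
    (hpa : (fun k : ℕ => (k : ℝ) ^ (-p)) =O[atTop] a)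
    (hS : S =O[atTop] fun k : ℕ => (k : ℝ) ^ (-(p + r)))
    (hrec : ∀ᶠ k in atTop, T (k + 1) ≤ (1 - a k) * T k + S k) :
    T =O[atTop] fun k : ℕ => (k : ℝ) ^ (-r) := by
  obtain ⟨c, hc, hca⟩ := hpa.exists_pos
  obtain ⟨B, hB, hSB⟩ := hS.exists_pos
  obtain ⟨k₀, hk₀⟩ := eventually_atTop.1 <| (ha1.and hca.bound).and <| (hSB.bound.and hrec).and <|
    (eventually_rpow_neg_sub_le hp hr (show 0 < 1 / (2 * c) by positivity)).and
      (eventually_ge_atTop 1)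
  set A := max (2 * c * B) (T k₀ * (k₀ : ℝ) ^ r)
  have hAB : 2 * c * B ≤ A := le_max_left _ _
  have hA : 0 ≤ A := le_trans (by positivity) hAB
  have hTA : ∀ k, k₀ ≤ k → T k ≤ A * (k : ℝ) ^ (-r) := by
    intro k hk
    induction k, hk using Nat.le_induction with
    | base =>
      have hk₀pos : (0 : ℝ) < k₀ := by exact_mod_cast (hk₀ k₀ le_rfl).2.2.2
      rw [Real.rpow_neg hk₀pos.le, ← div_eq_mul_inv, le_div_iff₀ (by positivity)]
      exact le_max_right _ _
    | succ k hk ih =>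
      obtain ⟨⟨ha1, hca⟩, ⟨hSB, hrec⟩, hdecay, hk1⟩ := hk₀ k hk
      rw [Real.norm_of_nonneg (by positivity), Real.norm_of_nonneg (ha k)] at hca
      rw [Real.norm_of_nonneg (by positivity : 0 ≤ (k : ℝ) ^ (-(p + r)))] at hSB
      rw [neg_add, Real.rpow_add (by exact_mod_cast hk1)] at hSB hdecay
      exact le_mul_of_contraction hA hc (by positivity) (by positivity) ha1 hca hAB
        ((le_abs_self _).trans hSB) hdecay ih hrec
  refine .of_bound A ?_
  filter_upwards [eventually_ge_atTop k₀] with k hk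
  rw [Real.norm_of_nonneg (hT k), Real.norm_of_nonneg (by positivity)]
  exact hTA k hk

lemma isBigO_of_perturbed_recurrence (hp : p < 1) (hr : 0 ≤ r) {α B R β ε : ℕ → ℝ}
    (hT : ∀ k, 0 ≤ T k) (hα : ∀ k, α k ∈ Set.Icc 0 1)
    (hpα : α =Θ[atTop] fun k : ℕ => (k : ℝ) ^ (-p)) (hβ : ∀ k, 0 ≤ β k)
    (hβO : β =O[atTop] fun k : ℕ => (k : ℝ) ^ (-1 : ℝ))
    (hε : ε =O[atTop] fun k : ℕ => (k : ℝ) ^ (-(p + r)))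
    (hR : R =O[atTop] fun k : ℕ => (k : ℝ) ^ (-r))
    (hTB : ∀ k, T (k + 1) ≤ (1 + β k) * B k + ε k)
    (hB : ∀ᶠ k in atTop, B k ≤ (1 - α k / 2) * T k + α k * R k) :
    T =O[atTop] fun k : ℕ => (k : ℝ) ^ (-r) := by
  have hβα : β =o[atTop] α := hβO.trans_isLittleO <|
    (isLittleO_natCast_rpow (by linarith)).trans_isBigO hpα.isBigO_symm
  have hαR : (fun k => α k * |R k|) =O[atTop] fun k : ℕ => (k : ℝ) ^ (-(p + r)) :=
    isBigO_mul_rpow hpα.isBigO hR.abs_left (by ring)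
  refine isBigO_of_linear_recurrence hp hr (a := fun k => 4⁻¹ * α k)
    (S := fun k => 2 * (α k * |R k|) + ε k) hT (.of_forall fun k => by linarith [(hα k).2])
    (fun k => mul_nonneg (by norm_num) (hα k).1)
    (hpα.isBigO_symm.const_mul_right (by norm_num)) ((hαR.const_mul_left 2).add hε) ?_
  filter_upwards [hβα.bound (show (0 : ℝ) < 4⁻¹ by norm_num), hB] with k hβk hB
  obtain ⟨hα0, hα1⟩ := hα k
  rw [Real.norm_of_nonneg (hβ k), Real.norm_of_nonneg hα0] at hβk
  have hstep : (1 + β k) * B k ≤ (1 + β k) * ((1 - α k / 2) * T k + α k * |R k|) := by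
    have := hβ k
    gcongr
    exact hB.trans (by gcongr; exact le_abs_self _)
  have hcontract : (1 + β k) * (1 - α k / 2) * T k ≤ (1 - 4⁻¹ * α k) * T k :=
    mul_le_mul_of_nonneg_right (by nlinarith [hβ k]) (hT k)
  have hrem : (1 + β k) * (α k * |R k|) ≤ 2 * (α k * |R k|) := by
    gcongr
    linarith
  linarith [hTB k]

end Rates

/-! ### Absorbing a quadratic term into a `q`-th power -/

section Young

variable {q κ r s : ℝ}

lemma mul_sq_le_half_rpow_add {a d : ℝ} (hq : 2 < q) (hκ : 0 < κ) (ha : 0 ≤ a) (hd : 0 ≤ d) :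
    a * d ^ 2 ≤ κ / 2 * d ^ q + a * (2 / κ * a) ^ (2 / (q - 2)) := by
  have hq2 : 0 < q - 2 := by linarith
  have hsplit : d ^ q = d ^ (q - 2) * d ^ 2 := by
    rw [← Real.rpow_natCast d 2, ← Real.rpow_add' hd (by push_cast; linarith)]
    push_cast; ring_nf
  rcases le_or_gt (2 / κ * a) (d ^ (q - 2)) with h | h
  · have hlarge : a * d ^ 2 ≤ κ / 2 * d ^ q := by
      rw [div_mul_eq_mul_div, div_le_iff₀ hκ] at h
      rw [hsplit, ← mul_assoc]
      gcongr
      linarith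
    exact hlarge.trans (le_add_of_nonneg_right (by positivity))
  · have hsmall : d ^ 2 ≤ (2 / κ * a) ^ (2 / (q - 2)) := by
      calc d ^ 2 = (d ^ (q - 2)) ^ (2 / (q - 2)) := by
            rw [← Real.rpow_mul hd, mul_div_cancel₀ _ hq2.ne', Real.rpow_two]
        _ ≤ (2 / κ * a) ^ (2 / (q - 2)) := by gcongr
    exact (mul_le_mul_of_nonneg_left hsmall ha).trans (le_add_of_nonneg_left (by positivity))

lemma exists_isBigO_mul_sq_le_half_rpow_add (hq : 2 ≤ q) (hκ : 0 < κ) (hs : 0 < s)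
    (hrs : r * (1 - 2 / q) ≤ s) {a : ℕ → ℝ} (ha : ∀ k, 0 ≤ a k)
    (haO : a =O[atTop] fun k : ℕ => (k : ℝ) ^ (-s)) :
    ∃ R : ℕ → ℝ, R =O[atTop] (fun k : ℕ => (k : ℝ) ^ (-r)) ∧
      ∀ᶠ k in atTop, ∀ d, 0 ≤ d → a k * d ^ 2 ≤ κ / 2 * d ^ q + R k := by
  rcases hq.eq_or_lt with rfl | hq
  · refine ⟨0, isBigO_zero _ _, ?_⟩
    filter_upwards [(haO.trans_tendsto (tendsto_natCast_rpow_of_neg (neg_neg_of_pos hs))).eventually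
      (ge_mem_nhds (half_pos hκ))] with k hk d _
    rw [Real.rpow_two, Pi.zero_apply, add_zero]
    gcongr
  · refine ⟨fun k => a k * (2 / κ * a k) ^ (2 / (q - 2)), ?_,
      .of_forall fun k d hd => mul_sq_le_half_rpow_add hq hκ (ha k) hd⟩
    have : 0 < q - 2 := by linarith
    refine (isBigO_mul_rpow haO (isBigO_rpow_rpow (by positivity) (haO.const_mul_left (2 / κ))
      rfl) rfl).trans (isBigO_natCast_rpow ?_)
    have hexp : s - r * (1 - 2 / q) = (s * (1 + 2 / (q - 2)) - r) * (1 - 2 / q) := by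
      field_simp
      ring
    have hcoef : 0 < 1 - 2 / q := by
      rw [sub_pos, div_lt_one (by linarith)]
      exact hq
    have := nonneg_of_mul_nonneg_left (hexp ▸ sub_nonneg.2 hrs) hcoef
    linarith

end Young

/-! ### Trajectories of the conditional gradient augmented Lagrangian method -/

/-- The sequences `x, z, v` are generated by the conditional gradient augmented Lagrangian method
on `P` with primal stepsizes `α`, penalty parameters `lam` and summable dual stepsizes `σ`. -/
structure Program.IsTrajectory [Fintype ι] (P : Program E ι) (α lam σ : ℕ → ℝ) (x : ℕ → E)
    (z : ℕ → ι → ℝ) (v : ℕ → E) : Prop where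
  α_mem : ∀ k, α k ∈ Set.Icc 0 1
  lam_pos : ∀ k, 0 < lam k
  lam_monotone : Monotone lam
  σ_nonneg : ∀ k, 0 ≤ σ k
  σ_le : ∀ k, σ k ≤ lam k
  σ_summable : Summable σ
  x_zero : x 0 ∈ P.C
  z_zero : 0 ≤ z 0
  v_isLinMin : ∀ k, IsLinMin P.C (P.augGrad (lam k) (x k) (z k)) (v k)
  x_succ : ∀ k, x (k + 1) = x k + α k • (v k - x k)
  z_succ : ∀ k i, z (k + 1) i = z k i + σ k * residual (lam k) (P.g i (x (k + 1))) (z k i)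

/-- The rate, relative to `lam k`, at which the updates of the penalty parameter and of the
multipliers convert squared residuals into augmented Lagrangian value. -/
noncomputable def drift (lam σ : ℕ → ℝ) (k : ℕ) : ℝ :=
  ((lam (k + 1) - lam k) / 2 + σ k) / lam k

namespace Program.IsTrajectory

variable [Fintype ι] {P : Program E ι} {α lam σ : ℕ → ℝ} {x v : ℕ → E} {z : ℕ → ι → ℝ} {xs : E}
  {zs : ι → ℝ}

lemma x_mem (ht : P.IsTrajectory α lam σ x z v) (k : ℕ) : x k ∈ P.C := by
  induction k with
  | zero => exact ht.x_zero
  | succ k ih =>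
    rw [ht.x_succ]
    exact P.convex.add_smul_sub_mem ih (ht.v_isLinMin k).1 (ht.α_mem k)

lemma z_nonneg (ht : P.IsTrajectory α lam σ x z v) (k : ℕ) : 0 ≤ z k := by
  induction k with
  | zero => exact ht.z_zero
  | succ k ih =>
    intro i
    have hshrink : 0 ≤ (1 - σ k / lam k) * z k i :=
      mul_nonneg (sub_nonneg.2 ((div_le_one (ht.lam_pos k)).2 (ht.σ_le k))) (ih i)
    calc 0 ≤ (1 - σ k / lam k) * z k i := hshrink
      _ = z k i + σ k * (-z k i / lam k) := by ring
      _ ≤ z (k + 1) i := by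
        rw [ht.z_succ]
        gcongr
        · exact ht.σ_nonneg k
        · exact le_max_left _ _

lemma exists_z_le (ht : P.IsTrajectory α lam σ x z v) : ∃ Z : ι → ℝ, ∀ k, z k ≤ Z := by
  choose M hM using fun i => (P.smooth_g i).exists_abs_le P.isBounded
  refine ⟨fun i => z 0 i + (∑' j, σ j) * M i, fun k i => ?_⟩
  have hpartial : z k i ≤ z 0 i + (∑ j ∈ Finset.range k, σ j) * M i := by
    induction k with
    | zero => simp
    | succ k ih =>
      have hres : residual (lam k) (P.g i (x (k + 1))) (z k i) ≤ M i :=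
        max_le ((div_nonpos_of_nonpos_of_nonneg (neg_nonpos.2 (ht.z_nonneg k i))
          (ht.lam_pos k).le).trans (M i).coe_nonneg)
          ((le_abs_self _).trans (hM i _ (ht.x_mem (k + 1))))
      rw [ht.z_succ, Finset.sum_range_succ]
      linarith [mul_le_mul_of_nonneg_left hres (ht.σ_nonneg k)]
  have hsum := ht.σ_summable.sum_le_tsum (Finset.range k) fun j _ => ht.σ_nonneg j
  exact hpartial.trans (add_le_add le_rfl (mul_le_mul_of_nonneg_right hsum (M i).coe_nonneg))

lemma exists_augF_succ_le (ht : P.IsTrajectory α lam σ x z v) :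
    ∃ c : ℝ≥0, ∀ k, P.augF (lam k) (x (k + 1)) (z k) ≤ P.augF (lam k) (x k) (z k) -
      α k * (P.fwGap (lam k) (x k) (z k) (v k) - c * (lam k * α k) * ‖v k - x k‖ ^ 2) := by
  obtain ⟨Z, hZ⟩ := ht.exists_z_le
  obtain ⟨c, hc⟩ := P.exists_augF_le (ht.lam_pos 0) Z
  refine ⟨c, fun k => ?_⟩
  have hdesc := hc (lam k) (z k) (ht.lam_monotone k.zero_le) (hZ k) _ (ht.x_mem k) _
    (ht.x_mem (k + 1))
  rw [ht.x_succ, add_sub_cancel_left, norm_smul, inner_smul_right, mul_pow, Real.norm_eq_abs,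
    sq_abs, ← ht.x_succ, ← neg_sub (x k) (v k), inner_neg_right, norm_neg] at hdesc
  rw [fwGap, norm_sub_rev]
  linarith

lemma exists_sum_residual_sq_le (ht : P.IsTrajectory α lam σ x z v) (hs : P.IsSaddle xs zs) :
    ∃ K : ℝ≥0, ∀ k, ∀ y ∈ P.C, lam k / 4 * ∑ i, residual (lam k) (P.g i y) (z k i) ^ 2 ≤
      P.gap xs (lam k) y (z k) + K / lam k := by
  obtain ⟨Z, hZ⟩ := ht.exists_z_le
  refine ⟨.mk (∑ i, (Z i + zs i) ^ 2) (by positivity), fun k y hy => ?_⟩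
  refine (hs.sum_residual_sq_le (ht.lam_pos k) hy (z k)).trans ?_
  rw [NNReal.coe_mk]
  have hsq : ∑ i, (z k i - zs i) ^ 2 ≤ ∑ i, (Z i + zs i) ^ 2 := Finset.sum_le_sum fun i _ =>
    sq_le_sq' (by linarith [hZ k i, show 0 ≤ z k i from ht.z_nonneg k i])
      (by linarith [hZ k i, hs.nonneg i])
  have := ht.lam_pos k
  gcongr

lemma augF_succ_succ_le (ht : P.IsTrajectory α lam σ x z v) (k : ℕ) :
    P.augF (lam (k + 1)) (x (k + 1)) (z (k + 1)) ≤ P.augF (lam k) (x (k + 1)) (z k) +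
      ((lam (k + 1) - lam k) / 2 + σ k) *
        ∑ i, residual (lam k) (P.g i (x (k + 1))) (z k i) ^ 2 := by
  have hpsi := Finset.sum_le_sum fun i (_ : i ∈ Finset.univ) =>
    psi_update_le (ht.lam_pos k) (ht.lam_pos (k + 1)) (P.g i (x (k + 1))) (z k i) (z (k + 1) i)
  have hdual (i : ι) : (z (k + 1) i - z k i) * residual (lam k) (P.g i (x (k + 1))) (z k i) =
      σ k * residual (lam k) (P.g i (x (k + 1))) (z k i) ^ 2 := by
    rw [ht.z_succ]; ring
  simp only [hdual, Finset.sum_add_distrib, ← Finset.mul_sum] at hpsi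
  rw [augF, augF]
  linarith

lemma drift_nonneg (ht : P.IsTrajectory α lam σ x z v) (k : ℕ) : 0 ≤ drift lam σ k :=
  div_nonneg (add_nonneg (div_nonneg (sub_nonneg.2 (ht.lam_monotone k.le_succ)) zero_le_two)
    (ht.σ_nonneg k)) (ht.lam_pos k).le

lemma exists_gap_succ_le (ht : P.IsTrajectory α lam σ x z v) (hs : P.IsSaddle xs zs) :
    ∃ K : ℝ≥0, ∀ k, P.gap xs (lam (k + 1)) (x (k + 1)) (z (k + 1)) ≤
      (1 + 4 * drift lam σ k) * P.gap xs (lam k) (x (k + 1)) (z k) +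
        4 * drift lam σ k * (K / lam k) := by
  obtain ⟨K, hK⟩ := ht.exists_sum_residual_sq_le hs
  refine ⟨K, fun k => ?_⟩
  have hlam := ht.lam_pos k
  have hd := ht.drift_nonneg k
  have hgap := P.gap_nonneg xs (lam k) (x (k + 1)) (z k)
  have hupdate := ht.augF_succ_succ_le k
  have hδ : (lam (k + 1) - lam k) / 2 + σ k = 4 * drift lam σ k * (lam k / 4) := by
    rw [drift]; field_simp
  have hres := mul_le_mul_of_nonneg_left (hK k _ (ht.x_mem (k + 1)))
    (mul_nonneg zero_le_four hd)
  rw [hδ, mul_assoc] at hupdate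
  refine max_le ?_ (by positivity)
  linarith [P.sub_le_gap xs (lam k) (x (k + 1)) (z k)]

end Program.IsTrajectory

/-! ### Rates of convergence -/

/-- The parameters have polynomial orders: `α = Θ(k⁻ᵖ)` and `lam = Θ(k^τ)` with `0 < τ < p < 1`, the
increments of `lam` and the dual stepsizes `σ` being of the order of `k^(τ - 1)`. -/
structure PolynomialRates (τ p : ℝ) (α lam σ : ℕ → ℝ) : Prop where
  τ_pos : 0 < τ
  p_mem : p ∈ Set.Ioo τ 1
  lam_theta : lam =Θ[atTop] fun k : ℕ => (k : ℝ) ^ τ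
  lam_diff : (fun k => lam (k + 1) - lam k) =O[atTop] fun k : ℕ => (k : ℝ) ^ (-(1 - τ))
  α_theta : α =Θ[atTop] fun k : ℕ => (k : ℝ) ^ (-p)
  σ_isBigO : σ =O[atTop] fun k : ℕ => (k : ℝ) ^ (-(1 - τ))

/-- The scaling inequality of a `q`-uniformly convex set: at a solution `v` of a linear minimization
problem over `C`, the linear objective grows with the `q`-th power of the distance to `v`. -/
def ScalingInequality (κ q : ℝ) (C : Set E) : Prop :=
  ∀ u v, IsLinMin C u v → ∀ x ∈ C, κ * ‖u‖ * ‖v - x‖ ^ q ≤ ⟪u, x - v⟫_ℝ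

/-- The infeasibility measure `‖[g(x)]₊‖`. -/
noncomputable def Program.infeasibility [Fintype ι] (P : Program E ι) (x : E) : ℝ :=
  ‖(WithLp.toLp 2 fun i => max (P.g i x) 0 : EuclideanSpace ℝ ι)‖

namespace PolynomialRates

variable {τ p : ℝ} {α lam σ : ℕ → ℝ}

lemma isBigO_inv_lam (h : PolynomialRates τ p α lam σ) :
    (fun k => (lam k)⁻¹) =O[atTop] fun k : ℕ => (k : ℝ) ^ (-τ) :=
  isBigO_inv_rpow h.lam_theta.isBigO_symm

lemma isBigO_lam_mul (h : PolynomialRates τ p α lam σ) :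
    (fun k => lam k * α k) =O[atTop] fun k : ℕ => (k : ℝ) ^ (-(p - τ)) :=
  isBigO_mul_rpow h.lam_theta.isBigO h.α_theta.isBigO (by ring)

lemma isBigO_drift (h : PolynomialRates τ p α lam σ) :
    drift lam σ =O[atTop] fun k : ℕ => (k : ℝ) ^ (-1 : ℝ) := by
  have hsum : (fun k => (lam (k + 1) - lam k) / 2 + σ k) =O[atTop]
      fun k : ℕ => (k : ℝ) ^ (-(1 - τ)) := by
    simpa only [div_eq_inv_mul] using (h.lam_diff.const_mul_left 2⁻¹).add h.σ_isBigO
  exact isBigO_mul_rpow hsum h.isBigO_inv_lam (by ring)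

end PolynomialRates

namespace Program.IsTrajectory

variable [Fintype ι] {P : Program E ι} {τ p r : ℝ} {α lam σ : ℕ → ℝ} {x v : ℕ → E}
  {z : ℕ → ι → ℝ} {xs : E} {zs : ι → ℝ}

lemma isBigO_gap_of_sq_le (ht : P.IsTrajectory α lam σ x z v) (hs : P.IsSaddle xs zs)
    (hrates : PolynomialRates τ p α lam σ) (hr : 0 ≤ r) (hrp : r ≤ 1 - p + τ)
    (hsq : ∀ c : ℝ≥0, ∃ R : ℕ → ℝ, R =O[atTop] (fun k : ℕ => (k : ℝ) ^ (-r)) ∧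
      ∀ᶠ k in atTop, c * (lam k * α k) * ‖v k - x k‖ ^ 2 ≤
        P.fwGap (lam k) (x k) (z k) (v k) / 2 + R k) :
    (fun k => P.gap xs (lam k) (x k) (z k)) =O[atTop] fun k : ℕ => (k : ℝ) ^ (-r) := by
  obtain ⟨c, hdesc⟩ := ht.exists_augF_succ_le
  obtain ⟨R, hR, hcR⟩ := hsq c
  obtain ⟨K, hupdate⟩ := ht.exists_gap_succ_le hs
  have hε : (fun k => 4 * drift lam σ k * (K / lam k)) =O[atTop]
      fun k : ℕ => (k : ℝ) ^ (-(p + r)) :=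
    (isBigO_mul_rpow (hrates.isBigO_drift.const_mul_left 4)
      (hrates.isBigO_inv_lam.const_mul_left (K : ℝ)) rfl).trans
      (isBigO_natCast_rpow (by linarith))
  refine isBigO_of_perturbed_recurrence hrates.p_mem.2 hr
    (fun k => P.gap_nonneg xs _ _ _) ht.α_mem hrates.α_theta
    (fun k => mul_nonneg zero_le_four (ht.drift_nonneg k))
    (hrates.isBigO_drift.const_mul_left 4) hε hR.abs_left hupdate ?_
  filter_upwards [hcR] with k hcR
  obtain ⟨hα0, hα1⟩ := ht.α_mem k
  have hgap0 := P.gap_nonneg xs (lam k) (x k) (z k)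
  have hfw := hs.gap_le_fwGap (ht.lam_pos k) (ht.v_isLinMin k) (ht.x_mem k)
  have hprogress : α k * (P.gap xs (lam k) (x k) (z k) / 2 - |R k|) ≤ α k *
      (P.fwGap (lam k) (x k) (z k) (v k) - c * (lam k * α k) * ‖v k - x k‖ ^ 2) :=
    mul_le_mul_of_nonneg_left (by linarith [le_abs_self (R k)]) hα0
  refine max_le ?_ (add_nonneg (mul_nonneg (by linarith) hgap0) (by positivity))
  linarith [hdesc k, P.sub_le_gap xs (lam k) (x k) (z k)]

lemma isBigO_gap_rpow_zero (ht : P.IsTrajectory α lam σ x z v) (hs : P.IsSaddle xs zs)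
    (hrates : PolynomialRates τ p α lam σ) :
    (fun k => P.gap xs (lam k) (x k) (z k)) =O[atTop] fun k : ℕ => (k : ℝ) ^ (-0 : ℝ) := by
  obtain ⟨hτp, hp1⟩ := hrates.p_mem
  obtain ⟨D, hD⟩ := Metric.isBounded_iff.1 P.isBounded
  refine ht.isBigO_gap_of_sq_le hs hrates le_rfl (by linarith [hrates.τ_pos]) fun c =>
    ⟨fun k => c * (lam k * α k) * D ^ 2, ?_, .of_forall fun k => ?_⟩
  · simpa only [mul_comm _ (D ^ 2)] using
      ((hrates.isBigO_lam_mul.trans (isBigO_natCast_rpow (by linarith))).const_mul_left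
        (c : ℝ)).const_mul_left (D ^ 2)
  · have hvx : ‖v k - x k‖ ^ 2 ≤ D ^ 2 := by
      gcongr
      simpa only [dist_eq_norm] using hD (ht.v_isLinMin k).1 (ht.x_mem k)
    have hcoef : 0 ≤ c * (lam k * α k) :=
      mul_nonneg c.coe_nonneg (mul_nonneg (ht.lam_pos k).le (ht.α_mem k).1)
    linarith [mul_le_mul_of_nonneg_left hvx hcoef, fwGap_nonneg (ht.v_isLinMin k) (ht.x_mem k)]

lemma isBigO_sum_residual_sq (ht : P.IsTrajectory α lam σ x z v) (hs : P.IsSaddle xs zs)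
    (hrates : PolynomialRates τ p α lam σ) (hrτ : r ≤ τ)
    (hgap : (fun k => P.gap xs (lam k) (x k) (z k)) =O[atTop] fun k : ℕ => (k : ℝ) ^ (-r)) :
    (fun k => ∑ i, residual (lam k) (P.g i (x k)) (z k i) ^ 2) =O[atTop]
      fun k : ℕ => (k : ℝ) ^ (-(τ + r)) := by
  obtain ⟨K, hK⟩ := ht.exists_sum_residual_sq_le hs
  have hinv := hrates.isBigO_inv_lam
  have hbound := isBigO_mul_rpow (hinv.const_mul_left 4) (hgap.add ((hinv.trans
    (isBigO_natCast_rpow (neg_le_neg hrτ))).const_mul_left (K : ℝ))) (neg_add τ r).symm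
  refine (IsBigO.of_norm_le fun k => ?_).trans hbound
  have hlam := ht.lam_pos k
  have hK := mul_le_mul_of_nonneg_left (hK k _ (ht.x_mem k)) (show 0 ≤ 4 * (lam k)⁻¹ by positivity)
  rw [← mul_assoc, show 4 * (lam k)⁻¹ * (lam k / 4) = 1 by field_simp, one_mul] at hK
  rw [Real.norm_of_nonneg (by positivity)]
  exact hK

lemma isBigO_infeasibility (ht : P.IsTrajectory α lam σ x z v) (hs : P.IsSaddle xs zs)
    (hrates : PolynomialRates τ p α lam σ) (hrτ : r ≤ τ)
    (hgap : (fun k => P.gap xs (lam k) (x k) (z k)) =O[atTop] fun k : ℕ => (k : ℝ) ^ (-r)) :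
    (fun k => P.infeasibility (x k)) =O[atTop] fun k : ℕ => (k : ℝ) ^ (-r) := by
  refine .of_pow (n := 2) two_ne_zero ?_
  have hsq : ((fun k : ℕ => (k : ℝ) ^ (-r)) ^ 2) =ᶠ[atTop] fun k : ℕ => (k : ℝ) ^ (-(r + r)) := by
    simp only [sq]
    exact natCast_rpow_mul_rpow_eventuallyEq (neg_add r r).symm
  refine IsBigO.trans_eventuallyEq ?_ hsq.symm
  refine (IsBigO.of_norm_le fun k => ?_).trans <|
    (ht.isBigO_sum_residual_sq hs hrates hrτ hgap).trans (isBigO_natCast_rpow (by linarith))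
  rw [Pi.pow_apply, infeasibility, norm_pow, norm_norm, EuclideanSpace.norm_sq_eq]
  refine Finset.sum_le_sum fun i _ => ?_
  rw [Real.norm_eq_abs, sq_abs, PiLp.toLp_apply]
  rcases le_total (P.g i (x k)) 0 with h | h
  · rw [max_eq_right h, zero_pow two_ne_zero]
    exact sq_nonneg _
  · rw [max_eq_left h]
    exact pow_le_pow_left₀ h (le_max_right _ _) 2

lemma exists_sub_le_gap_add (ht : P.IsTrajectory α lam σ x z v) :
    ∃ K : ℝ, ∀ k, P.f (x k) - P.f xs ≤ P.gap xs (lam k) (x k) (z k) + K * (lam k)⁻¹ := by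
  obtain ⟨Z, hZ⟩ := ht.exists_z_le
  refine ⟨∑ i, Z i ^ 2 / 2, fun k => ?_⟩
  have hlam := ht.lam_pos k
  have hpsi : -((∑ i, Z i ^ 2 / 2) * (lam k)⁻¹) ≤ ∑ i, psi (lam k) (P.g i (x k)) (z k i) := by
    rw [Finset.sum_mul, ← Finset.sum_neg_distrib]
    refine Finset.sum_le_sum fun i _ => le_trans ?_ (neg_sq_div_le_psi hlam _ _)
    rw [neg_le_neg_iff, ← div_eq_mul_inv, div_div]
    have := pow_le_pow_left₀ (ht.z_nonneg k i) (hZ k i) 2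
    gcongr
  have hgap := P.sub_le_gap xs (lam k) (x k) (z k)
  rw [augF] at hgap
  linarith

lemma isBigO_objective (ht : P.IsTrajectory α lam σ x z v) (hs : P.IsSaddle xs zs)
    (hrates : PolynomialRates τ p α lam σ) (hrτ : r ≤ τ)
    (hgap : (fun k => P.gap xs (lam k) (x k) (z k)) =O[atTop] fun k : ℕ => (k : ℝ) ^ (-r)) :
    (fun k => P.f (x k) - P.f xs) =O[atTop] fun k : ℕ => (k : ℝ) ^ (-r) := by
  obtain ⟨K, hK⟩ := ht.exists_sub_le_gap_add (xs := xs)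
  have hinv := (hrates.isBigO_inv_lam.trans (isBigO_natCast_rpow (neg_le_neg hrτ))).const_mul_left K
  have hinf := (ht.isBigO_infeasibility hs hrates hrτ hgap).const_mul_left (∑ i, zs i)
  refine (IsBigO.of_norm_le fun k => ?_).trans ((hgap.add hinv).norm_left.add hinf.norm_left)
  have hlower : P.f xs - P.f (x k) ≤ (∑ i, zs i) * P.infeasibility (x k) := by
    have hsum : ∑ i, zs i * P.g i (x k) ≤ (∑ i, zs i) * P.infeasibility (x k) := by
      rw [Finset.sum_mul]
      refine Finset.sum_le_sum fun i _ => mul_le_mul_of_nonneg_left ?_ (hs.nonneg i)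
      exact (le_max_left _ _).trans <| (le_abs_self _).trans <|
        PiLp.norm_apply_le (WithLp.toLp 2 fun i => max (P.g i (x k)) 0 : EuclideanSpace ℝ ι) i
    linarith [hs.le_lagrangian _ (ht.x_mem k)]
  have hupper := (hK k).trans (Real.le_norm_self _)
  have hlower := hlower.trans (Real.le_norm_self _)
  rw [Real.norm_eq_abs (P.f (x k) - P.f xs), abs_le]
  constructor
  · linarith [norm_nonneg (P.gap xs (lam k) (x k) (z k) + K * (lam k)⁻¹)]
  · linarith [norm_nonneg ((∑ i, zs i) * P.infeasibility (x k))]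

lemma eventually_le_and_multiplier_eq_zero (ht : P.IsTrajectory α lam σ x z v)
    (hs : P.IsSaddle xs zs) (hrates : PolynomialRates τ p α lam σ) {ε : ℝ} (hε : 0 < ε) :
    ∀ᶠ k in atTop, (∀ i, P.g i (x k) ≤ ε) ∧
      ∀ i, P.g i (x k) < -ε → P.multiplier (lam k) (x k) (z k) i = 0 := by
  obtain ⟨Z, hZ⟩ := ht.exists_z_le
  have hτ := hrates.τ_pos
  have hres : ∀ᶠ k in atTop, ∑ i, residual (lam k) (P.g i (x k)) (z k i) ^ 2 < ε ^ 2 :=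
    ((ht.isBigO_sum_residual_sq hs hrates hτ.le (ht.isBigO_gap_rpow_zero hs hrates)).trans_tendsto
      (tendsto_natCast_rpow_of_neg (by linarith))).eventually_lt_const (by positivity)
  have hinv : ∀ᶠ k in atTop, ∀ i, Z i * (lam k)⁻¹ < ε := eventually_all.2 fun i =>
    ((hrates.isBigO_inv_lam.const_mul_left (Z i)).trans_tendsto
      (tendsto_natCast_rpow_of_neg (by linarith))).eventually_lt_const hε
  filter_upwards [hres, hinv] with k hres hinv
  have hlam := ht.lam_pos k
  refine ⟨fun i => ?_, fun i hi => max_eq_right ?_⟩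
  · have hi := Finset.single_le_sum
      (f := fun i => residual (lam k) (P.g i (x k)) (z k i) ^ 2) (fun i _ => sq_nonneg _)
      (Finset.mem_univ i)
    exact (le_max_right _ _).trans (abs_le_of_sq_le_sq' (hi.trans hres.le) hε.le).2
  · have hzZ := (hZ k i).trans ((mul_inv_lt_iff₀ hlam).1 (hinv i)).le
    linarith [mul_lt_mul_of_pos_left hi hlam]

lemma exists_eventually_rpow_le_fwGap (ht : P.IsTrajectory α lam σ x z v)
    (hs : P.IsSaddle xs zs) (hrates : PolynomialRates τ p α lam σ) {κ q : ℝ} (hκ : 0 < κ)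
    (hC : ScalingInequality κ q P.C) (hP : P.Nondegenerate) :
    ∃ κ' > 0, ∀ᶠ k in atTop,
      κ' * ‖v k - x k‖ ^ q ≤ P.fwGap (lam k) (x k) (z k) (v k) := by
  obtain ⟨ε, hε, ζ, hζ, hgrad⟩ := hP
  refine ⟨κ * ζ, mul_pos hκ hζ, ?_⟩
  filter_upwards [ht.eventually_le_and_multiplier_eq_zero hs hrates hε] with k hk
  have hnorm := hgrad (x k) (ht.x_mem k) _ hk.1 (fun i => le_max_right _ _) hk.2
  exact le_trans (by gcongr; exact hnorm) (hC _ _ (ht.v_isLinMin k) _ (ht.x_mem k))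

lemma isBigO_gap (ht : P.IsTrajectory α lam σ x z v) (hs : P.IsSaddle xs zs)
    (hrates : PolynomialRates τ p α lam σ) {κ q : ℝ} (hκ : 0 < κ) (hq : 2 ≤ q)
    (hC : ScalingInequality κ q P.C) (hP : P.Nondegenerate) (hr : 0 ≤ r) (hrp : r ≤ 1 - p + τ)
    (hrq : r * (1 - 2 / q) ≤ p - τ) :
    (fun k => P.gap xs (lam k) (x k) (z k)) =O[atTop] fun k : ℕ => (k : ℝ) ^ (-r) := by
  obtain ⟨κ', hκ', hfw⟩ := ht.exists_eventually_rpow_le_fwGap hs hrates hκ hC hP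
  refine ht.isBigO_gap_of_sq_le hs hrates hr hrp fun c => ?_
  obtain ⟨R, hR, hyoung⟩ := exists_isBigO_mul_sq_le_half_rpow_add hq hκ'
    (sub_pos.2 hrates.p_mem.1) hrq
    (fun k => mul_nonneg c.coe_nonneg (mul_nonneg (ht.lam_pos k).le (ht.α_mem k).1))
    (hrates.isBigO_lam_mul.const_mul_left (c : ℝ))
  refine ⟨R, hR, ?_⟩
  filter_upwards [hfw, hyoung] with k hfw hyoung
  linarith [hyoung ‖v k - x k‖ (norm_nonneg _)]

end Program.IsTrajectory

theorem proposition5p4_general [Fintype ι] {P : Program E ι} {xs : E} {zs : ι → ℝ}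
    (hs : P.IsSaddle xs zs) {κ q : ℝ} (hκ : 0 < κ) (hq : 2 ≤ q) (hC : ScalingInequality κ q P.C)
    (hP : P.Nondegenerate) {τ p : ℝ} {α lam σ : ℕ → ℝ} (hrates : PolynomialRates τ p α lam σ)
    {x v : ℕ → E} {z : ℕ → ι → ℝ} (ht : P.IsTrajectory α lam σ x z v) {r : ℝ} (hr : 0 ≤ r)
    (hrp : r ≤ 1 - p + τ) (hrq : r * (1 - 2 / q) ≤ p - τ) :
    (fun k => P.gap xs (lam k) (x k) (z k)) =O[atTop] (fun k : ℕ => (k : ℝ) ^ (-r)) ∧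
      (r ≤ τ →
        (fun k => P.f (x k) - P.f xs) =O[atTop] (fun k : ℕ => (k : ℝ) ^ (-r)) ∧
        (fun k => P.infeasibility (x k)) =O[atTop] fun k : ℕ => (k : ℝ) ^ (-r)) :=
  have hgap := ht.isBigO_gap hs hrates hκ hq hC hP hr hrp hrq
  ⟨hgap, fun hrτ => ⟨ht.isBigO_objective hs hrates hrτ hgap,
    ht.isBigO_infeasibility hs hrates hrτ hgap⟩⟩

/-! ### Smooth convex functions on a Hilbert space -/

section Gradient

variable [CompleteSpace E] {C : Set E} {φ : E → ℝ}

lemma add_inner_gradient_le (hφ : ConvexOn ℝ C φ) {x y : E} (hx : x ∈ C) (hy : y ∈ C)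
    (hd : DifferentiableAt ℝ φ x) : φ x + ⟪gradient φ x, y - x⟫_ℝ ≤ φ y := by
  have hline : ConvexOn ℝ _ fun t : ℝ => φ (AffineMap.lineMap x y t) :=
    hφ.comp_affineMap (AffineMap.lineMap x y)
  have hderiv : HasDerivAt (fun t : ℝ => φ (AffineMap.lineMap x y t))
      ⟪gradient φ x, y - x⟫_ℝ 0 := by
    have hgrad : HasFDerivAt φ (InnerProductSpace.toDual ℝ E (gradient φ x))
        (AffineMap.lineMap x y (0 : ℝ)) := by
      simpa only [AffineMap.lineMap_apply_zero] using hd.hasGradientAt.hasFDerivAt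
    exact hgrad.comp_hasDerivAt (0 : ℝ) AffineMap.hasDerivAt_lineMap
  have hslope := hline.le_slope_of_hasDerivAt (by simpa using hx) (by simpa using hy) zero_lt_one
    hderiv
  rw [slope_def_field, AffineMap.lineMap_apply_one, AffineMap.lineMap_apply_zero] at hslope
  linarith

lemma smoothConvexOn_gradient (hφ : ConvexOn ℝ C φ) (hd : ∀ x ∈ C, DifferentiableAt ℝ φ x)
    {L : ℝ} (hL : ∀ x ∈ C, ∀ y ∈ C, ‖gradient φ x - gradient φ y‖ ≤ L * ‖x - y‖) :
    SmoothConvexOn C φ (gradient φ) where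
  add_inner_le x hx _ hy := add_inner_gradient_le hφ hx hy (hd x hx)
  exists_lipschitz := ⟨_, .of_dist_le' fun x hx y hy => by
    simpa only [dist_eq_norm] using hL x hx y hy⟩

end Gradient

/-! ### The Euclidean problem as a convex program -/

variable {n m : ℕ} {f : EuclideanSpace ℝ (Fin n) → ℝ} {g : Fin m → EuclideanSpace ℝ (Fin n) → ℝ}
  {C : Set (EuclideanSpace ℝ (Fin n))}

lemma ind_of_mem {x : EuclideanSpace ℝ (Fin n)} (hx : x ∈ C) : ind C x = 0 := by simp [ind, hx]

lemma ind_of_notMem {x : EuclideanSpace ℝ (Fin n)} (hx : x ∉ C) : ind C x = ⊤ := by simp [ind, hx]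

lemma dom_ind (C : Set (EuclideanSpace ℝ (Fin n))) : dom (ind C) = C := by
  ext x
  by_cases hx : x ∈ C
  · simp [dom, ind_of_mem hx, hx]
  · simp [dom, ind_of_notMem hx, hx]

lemma IsLMO.isLinMin (hC : C.Nonempty) {u v : EuclideanSpace ℝ (Fin n)} (h : IsLMO (ind C) u v) :
    IsLinMin C u v := by
  have hv : v ∈ C := by
    by_contra hv
    obtain ⟨y, hy⟩ := hC
    have := h y
    rw [ind_of_notMem hv, ind_of_mem hy, EReal.coe_add_top, add_zero, top_le_iff] at this
    exact EReal.coe_ne_top _ this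
  refine ⟨hv, fun w hw => ?_⟩
  simpa only [ind_of_mem hv, ind_of_mem hw, add_zero, EReal.coe_le_coe_iff] using h w

lemma UniformlyConvexSet.scalingInequality {ν q : ℝ} (hC : UniformlyConvexSet ν q C) :
    ScalingInequality (ν / 2) q C := by
  intro u v hv x hx
  rcases eq_or_ne u 0 with rfl | hu
  · simp
  -- Minimality of `v` is tested at the midpoint of `x` and `v`, displaced in the direction `-u`.
  have hmem := hC.ball_mem x hx v hv.1 (1 / 2) (by norm_num) (-(‖u‖⁻¹ • u))
    (by simp [norm_smul, hu])
  have hmin := hv.2 _ hmem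
  have hnorm : ‖u‖⁻¹ * ‖u‖ ^ 2 = ‖u‖ := by field_simp
  simp only [inner_add_right, real_inner_smul_right, inner_neg_right, real_inner_self_eq_norm_sq,
    hnorm, norm_sub_rev x v] at hmin
  rw [inner_sub_right]
  linarith

lemma gradient_smoothPart (hf : Differentiable ℝ f) (hg : ∀ i, Differentiable ℝ (g i)) {lam : ℝ}
    (hlam : 0 < lam) (x : EuclideanSpace ℝ (Fin n)) (z : EuclideanSpace ℝ (Fin m)) :
    gradient (fun y => smoothPart f g lam y z) x =
      gradient f x + ∑ i, max (lam * g i x + z i) 0 • gradient (g i) x := by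
  refine (hasGradientAt_iff_hasFDerivAt.2 ?_).gradient
  have hpsi (i : Fin m) : HasFDerivAt (fun y => psi lam (g i y) (z i))
      (max (lam * g i x + z i) 0 • InnerProductSpace.toDual ℝ _ (gradient (g i) x)) x :=
    (hasDerivAt_psi hlam (g i x) (z i)).comp_hasFDerivAt x (hg i x).hasGradientAt.hasFDerivAt
  have hdual : InnerProductSpace.toDual ℝ _
      (gradient f x + ∑ i, max (lam * g i x + z i) 0 • gradient (g i) x) =
      InnerProductSpace.toDual ℝ _ (gradient f x) + ∑ i, max (lam * g i x + z i) 0 •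
        InnerProductSpace.toDual ℝ (EuclideanSpace ℝ (Fin n)) (gradient (g i) x) := by
    rw [map_add, map_sum]
    simp only [map_smulₛₗ]
    rfl
  rw [hdual]
  exact (hf x).hasGradientAt.hasFDerivAt.add
    (HasFDerivAt.fun_sum fun i (_ : i ∈ Finset.univ) => hpsi i)

/-- The convex program whose data are `f`, `g` and the set `C` with `h = ind C`. -/
noncomputable def StandingAssumption.toProgram (hs : StandingAssumption f (ind C) g)
    (hC : Convex ℝ C) : Program (EuclideanSpace ℝ (Fin n)) (Fin m) where
  C := C
  f := f
  f' := gradient f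
  g := g
  g' i := gradient (g i)
  convex := hC
  isBounded := by
    obtain ⟨D, -, hD⟩ := hs.h_bounded
    rw [dom_ind] at hD
    exact Metric.isBounded_iff.2
      ⟨D, fun x hx y hy => by simpa only [dist_eq_norm] using hD x hx y hy⟩
  smooth_f := by
    obtain ⟨L, -, hL⟩ := hs.f_lipschitz
    exact smoothConvexOn_gradient (hs.f_convex.subset (Set.subset_univ C) hC)
      (fun x _ => hs.f_differentiable x) fun x _ y _ => hL x y
  smooth_g i := by
    obtain ⟨L, -, hL⟩ := hs.g_lipschitz i
    rw [dom_ind] at hL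
    exact smoothConvexOn_gradient ((hs.g_convex i).subset (Set.subset_univ C) hC)
      (fun x _ => hs.g_differentiable i x) hL

lemma UCAssumption.nondegenerate {ν q : ℝ} (huc : UCAssumption f (ind C) g C ν q)
    (hs : StandingAssumption f (ind C) g) (hC : Convex ℝ C) : (hs.toProgram hC).Nondegenerate := by
  obtain ⟨ε, hε, ζ, hζ, hgrad⟩ := huc.grad_bound
  exact ⟨ε, hε, ζ, hζ, fun x hx z hxε hz0 hz =>
    hgrad x (WithLp.toLp 2 z) ⟨hxε, hz0, hz⟩ hx⟩

namespace IsKKT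

variable {xs : EuclideanSpace ℝ (Fin n)} {zs : EuclideanSpace ℝ (Fin m)}

lemma mem (hk : IsKKT f (ind C) g xs zs) (hC : C.Nonempty) : xs ∈ C := by
  by_contra hx
  obtain ⟨ξ, hξ, -⟩ := hk.stationary
  obtain ⟨y, hy⟩ := hC
  have := hξ y
  rw [ind_of_notMem hx, ind_of_mem hy, EReal.top_add_coe, top_le_iff] at this
  exact EReal.zero_ne_top this

lemma le_lagrangian (hk : IsKKT f (ind C) g xs zs) (hs : StandingAssumption f (ind C) g)
    {y : EuclideanSpace ℝ (Fin n)} (hy : y ∈ C) : f xs ≤ f y + ∑ i, zs i * g i y := by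
  obtain ⟨ξ, hξ, hstat⟩ := hk.stationary
  have hξ : ⟪ξ, y - xs⟫_ℝ ≤ 0 := by
    have := hξ y
    rw [ind_of_mem (hk.mem ⟨y, hy⟩), ind_of_mem hy, zero_add] at this
    exact_mod_cast this
  have hf := add_inner_gradient_le hs.f_convex (Set.mem_univ xs) (Set.mem_univ y)
    (hs.f_differentiable xs)
  have hg := Finset.sum_le_sum fun i (_ : i ∈ Finset.univ) => mul_le_mul_of_nonneg_left
    (add_inner_gradient_le (hs.g_convex i) (Set.mem_univ xs) (Set.mem_univ y)
      (hs.g_differentiable i xs)) (hk.dual_nonneg i)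
  have hinner := congrArg (fun u => ⟪u, y - xs⟫_ℝ) hstat
  simp only [inner_add_left, sum_inner, real_inner_smul_left, inner_zero_left] at hinner
  simp only [mul_add, Finset.sum_add_distrib, hk.complementary] at hg
  linarith

lemma isSaddle (hk : IsKKT f (ind C) g xs zs) (hs : StandingAssumption f (ind C) g)
    (hC : Convex ℝ C) (hC' : C.Nonempty) : (hs.toProgram hC).IsSaddle xs zs where
  mem := hk.mem hC'
  feasible := hk.feasible
  nonneg := hk.dual_nonneg
  le_lagrangian _ hy := hk.le_lagrangian hs hy

lemma optValue_eq (hk : IsKKT f (ind C) g xs zs) (hs : StandingAssumption f (ind C) g)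
    (hC : C.Nonempty) : optValue f (ind C) g = f xs := by
  refine le_antisymm ?_ (le_iInf₂ fun y hy => ?_)
  · exact (iInf₂_le xs hk.feasible).trans (by rw [ind_of_mem (hk.mem hC), add_zero])
  · by_cases hyC : y ∈ C
    · rw [ind_of_mem hyC, add_zero, EReal.coe_le_coe_iff]
      have hsum : ∑ i, zs i * g i y ≤ 0 := Finset.sum_nonpos fun i _ =>
        mul_nonpos_of_nonneg_of_nonpos (hk.dual_nonneg i) (hy i)
      linarith [hk.le_lagrangian hs hyC]
    · rw [ind_of_notMem hyC, EReal.coe_add_top]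
      exact le_top

lemma gapT_eq (hk : IsKKT f (ind C) g xs zs) (hs : StandingAssumption f (ind C) g)
    (hC : Convex ℝ C) {x : EuclideanSpace ℝ (Fin n)} (hx : x ∈ C) (lam : ℝ)
    (z : EuclideanSpace ℝ (Fin m)) :
    gapT f (ind C) g lam x z = (hs.toProgram hC).gap xs lam x z := by
  rw [gapT, augLagrangian, hk.optValue_eq hs ⟨x, hx⟩, ind_of_mem hx, add_zero, ← EReal.coe_sub,
    ← EReal.coe_zero, ← EReal.coe_strictMono.monotone.map_max]
  rfl

end IsKKT

lemma OpenLoop.polynomialRates {τ p γ : ℝ} {α lam σ : ℕ → ℝ} (hl : OpenLoop τ p γ α lam σ) :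
    PolynomialRates τ p α lam σ where
  τ_pos := hl.τ_mem.1
  p_mem := hl.p_mem
  lam_theta := hl.lam_theta
  lam_diff := hl.lam_diff
  α_theta := hl.α_theta
  σ_isBigO := hl.σ_theta.isBigO.trans <|
    isBigO_natCast_rpow (by linarith [hl.γ_pos, hl.τ_mem.1])

/-! ### Rates of extended-real sequences -/

lemma hasRate_of_eq_coe {a : ℕ → EReal} {b r : ℕ → ℝ} (hab : ∀ k, a k = b k) (hb : b =O[atTop] r) :
    HasRate a r := by
  obtain rfl : a = fun k => (b k : EReal) := funext hab
  exact ⟨fun k => ⟨EReal.coe_ne_bot _, EReal.coe_ne_top _⟩, hb⟩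

lemma HasRate.trans {a : ℕ → EReal} {r r' : ℕ → ℝ} (ha : HasRate a r) (hr : r =O[atTop] r') :
    HasRate a r' :=
  ⟨ha.1, ha.2.trans hr⟩

lemma isBigO_natCast_rpow_neg_min (a b : ℝ) :
    (fun k : ℕ => (k : ℝ) ^ (-min a b)) =O[atTop]
      fun k : ℕ => max ((k : ℝ) ^ (-a)) ((k : ℝ) ^ (-b)) := by
  refine .of_norm_le fun k => ?_
  rw [Real.norm_of_nonneg (by positivity)]
  rcases min_choice a b with h | h <;> rw [h]
  · exact le_max_left _ _
  · exact le_max_right _ _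

lemma min_exponent_mul_le {μ ω s : ℝ} (hμ0 : 0 ≤ μ) (hμ1 : μ ≤ 1) (hω : ω ≤ s) (hs : 0 ≤ s)
    (t : ℝ) : min ((1 - μ) * ω + s) t * μ ≤ s := by
  calc min ((1 - μ) * ω + s) t * μ ≤ ((1 - μ) * s + s) * μ := by
        have := sub_nonneg.2 hμ1
        gcongr
        exact (min_le_left _ _).trans (by gcongr)
    _ = s - s * (1 - μ) ^ 2 := by ring
    _ ≤ s := sub_le_self _ (by positivity)

namespace IsRun

variable {α lam σ : ℕ → ℝ} {x v : ℕ → EuclideanSpace ℝ (Fin n)} {z : ℕ → EuclideanSpace ℝ (Fin m)}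

lemma isTrajectory (hr : IsRun f (ind C) g α lam σ x z v) (hs : StandingAssumption f (ind C) g)
    (hC : Convex ℝ C) : (hs.toProgram hC).IsTrajectory α lam σ x (fun k => z k) v := by
  have hx : x 0 ∈ C := by simpa only [dom_ind] using hr.x_zero
  exact
    { α_mem := hr.α_mem
      lam_pos := hr.lam_pos
      lam_monotone := hr.lam_strictMono.monotone
      σ_nonneg := fun k => (hr.σ_pos k).le
      σ_le := hr.σ_le
      σ_summable := hr.σ_summable
      x_zero := hx
      z_zero := hr.z_zero
      v_isLinMin := fun k => by
        have hv := (hr.v_step k).isLinMin ⟨_, hx⟩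
        rwa [gradient_smoothPart hs.f_differentiable hs.g_differentiable (hr.lam_pos k)] at hv
      x_succ := hr.x_step
      z_succ := hr.z_step }

lemma hasRates (hr : IsRun f (ind C) g α lam σ x z v) (hs : StandingAssumption f (ind C) g)
    {ν q : ℝ} (huc : UCAssumption f (ind C) g C ν q) {τ p γ : ℝ}
    (hl : OpenLoop τ p γ α lam σ) {r : ℝ} (hr0 : 0 ≤ r) (hrp : r ≤ 1 - p + τ)
    (hrq : r * (1 - 2 / q) ≤ p - τ) :
    HasRate (fun k => gapT f (ind C) g (lam k) (x k) (z k)) (fun k => (k : ℝ) ^ (-r)) ∧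
      (r ≤ τ →
        HasRate (fun k => f (x k) + ind C (x k) - optValue f (ind C) g)
          (fun k => (k : ℝ) ^ (-r)) ∧
        (fun k => ‖(WithLp.toLp 2 fun i => max (g i (x k)) 0 : EuclideanSpace ℝ (Fin m))‖)
          =O[atTop] fun k : ℕ => (k : ℝ) ^ (-r)) := by
  have hC := huc.uniformlyConvex
  obtain ⟨xs, zs, hk⟩ := hs.exists_kkt
  have ht := hr.isTrajectory hs hC.convex
  have hCne : C.Nonempty := ⟨x 0, ht.x_mem 0⟩
  obtain ⟨hgap, hrest⟩ := proposition5p4_general (hk.isSaddle hs hC.convex hCne)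
    (half_pos hC.ν_pos) hC.two_le_q hC.scalingInequality (huc.nondegenerate hs hC.convex)
    hl.polynomialRates ht hr0 hrp hrq
  refine ⟨hasRate_of_eq_coe (fun k => hk.gapT_eq hs hC.convex (ht.x_mem k) _ _) hgap,
    fun hrτ => ⟨hasRate_of_eq_coe (fun k => ?_) (hrest hrτ).1, (hrest hrτ).2⟩⟩
  have hx : x k ∈ C := ht.x_mem k
  rw [ind_of_mem hx, add_zero, hk.optValue_eq hs hCne, ← EReal.coe_sub]
  rfl

end IsRun

end CGAL

theorem proposition5p4 {n m : ℕ} (f : EuclideanSpace ℝ (Fin n) → ℝ)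
    (h : EuclideanSpace ℝ (Fin n) → EReal) (g : Fin m → EuclideanSpace ℝ (Fin n) → ℝ)
    (C : Set (EuclideanSpace ℝ (Fin n))) (ν q μ : ℝ)
    (hstd : CGAL.StandingAssumption f h g) (huc : CGAL.UCAssumption f h g C ν q)
    (hμ : μ = 1 - 2 / q) :
    (∀ (τ p γ ω : ℝ) (α lam σ : ℕ → ℝ) (x : ℕ → EuclideanSpace ℝ (Fin n))
        (z : ℕ → EuclideanSpace ℝ (Fin m)) (v : ℕ → EuclideanSpace ℝ (Fin n)),
      CGAL.OpenLoop τ p γ α lam σ → CGAL.IsRun f h g α lam σ x z v →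
      ω = min (p - τ) (1 - p + τ) →
      (μ = 0 →
        CGAL.HasRate (fun k => CGAL.gapT f h g (lam k) (x k) (z k))
          (fun k => (k : ℝ) ^ (-(1 - p + τ)))) ∧
      (μ ∈ Set.Ioo (0 : ℝ) 1 →
        CGAL.HasRate (fun k => CGAL.gapT f h g (lam k) (x k) (z k))
          (fun k => max ((k : ℝ) ^ (-((1 - μ) * ω + p - τ))) ((k : ℝ) ^ (-(1 - p + τ)))))) ∧
    (μ = 0 → ∀ ρ : ℝ, ρ < 1 → ∃ τ₀ : ℝ, τ₀ < 1 ∧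
      ∀ (τ p γ : ℝ) (α lam σ : ℕ → ℝ) (x : ℕ → EuclideanSpace ℝ (Fin n))
        (z : ℕ → EuclideanSpace ℝ (Fin m)) (v : ℕ → EuclideanSpace ℝ (Fin n)),
      τ₀ < τ → CGAL.OpenLoop τ p γ α lam σ → CGAL.IsRun f h g α lam σ x z v →
      CGAL.HasRate (fun k => CGAL.gapT f h g (lam k) (x k) (z k)) (fun k => (k : ℝ) ^ (-ρ)) ∧
      CGAL.HasRate (fun k => (f (x k) : EReal) + h (x k) - CGAL.optValue f h g)
        (fun k => (k : ℝ) ^ (-ρ)) ∧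
      Asymptotics.IsBigO Filter.atTop
        (fun k => ‖(WithLp.toLp 2 fun i => max (g i (x k)) 0 : EuclideanSpace ℝ (Fin m))‖)
        (fun k : ℕ => (k : ℝ) ^ (-ρ))) := by
  obtain rfl := huc.h_eq
  subst hμ
  refine ⟨fun τ p γ ω α lam σ x z v hl hr hω => ⟨fun hμ => ?_, fun ⟨hμ0, hμ1⟩ => ?_⟩,
    fun hμ ρ hρ => ⟨ρ, hρ, fun τ p γ α lam σ x z v hρτ hl hr => ?_⟩⟩ <;>
    obtain ⟨⟨hτp, hp1⟩, hτ0⟩ := And.intro hl.p_mem hl.τ_mem.1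
  · exact (hr.hasRates hstd huc hl (by linarith) le_rfl (by rw [hμ]; linarith)).1
  · obtain ⟨hω0, hωp⟩ : 0 ≤ ω ∧ ω ≤ p - τ :=
      hω ▸ ⟨le_min (by linarith) (by linarith), min_le_left _ _⟩
    have hr0 := add_nonneg (mul_nonneg (sub_nonneg.2 hμ1.le) hω0) (sub_nonneg.2 hτp.le)
    have hrate := hr.hasRates hstd huc hl (le_min hr0 (by linarith)) (min_le_right _ _)
      (CGAL.min_exponent_mul_le hμ0.le hμ1.le hωp (by linarith) _)
    simpa only [add_sub_assoc] using hrate.1.trans (CGAL.isBigO_natCast_rpow_neg_min _ _)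
  · obtain ⟨hgap, hrest⟩ := hr.hasRates hstd huc hl hτ0.le (by linarith) (by rw [hμ]; linarith)
    obtain ⟨hobjective, hinfeasibility⟩ := hrest le_rfl
    have hτ := CGAL.isBigO_natCast_rpow (neg_le_neg hρτ.le)
    exact ⟨hgap.trans hτ, hobjective.trans hτ, hinfeasibility.trans hτ⟩
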